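/- For integers $n\ge 0$ and $k\ge 1$, a family $\mathcal F$ of subsets of $[n]=\{1,\dots,n\}$ is called $k$-antichain saturated if $\mathcal F$ contains no antichain of size $k$ (that is, no $k$ distinct members that are pairwise incomparable under inclusion), but for every $X\subseteq[n]$ with $X\notin\mathcal F$ the family $\mathcal F\cup\{X\}$ does contain an antichain of size $k$. Let $\mathrm{sat}^*(n,k)$ denote the smallest size of a $k$-antichain saturated family of subsets of $[n]$. Let $\ell\ge 0$, $k\ge 1$ and $n\ge 0$ be integers such that $\binom{\ell}{\lfloor \ell/2\rfloor}=k-1$. If $n\le \ell$, then $\mathrm{sat}^*(n,k)=2^n$. If $n\ge \ell+1$, then $$\mathrm{sat}^*(n,k)=2\sum_{j=0}^{\lfloor \ell/2\rfloor}\binom{\ell}{j}+(k-1)\bigl(n-1-2\lfloor \ell/2\rfloor\bigr).$$ In particular, whenever $k-1$ is a central binomial coefficient $\binom{\ell}{\lfloor\ell/2\rfloor}$, the value of $\mathrm{sat}^*(n,k)$ is determined for every $n$. -/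

import Mathlib

/-- The family `F` of subsets of an `n`-element set contains an antichain of size `k`:
`k` members of `F` that are pairwise incomparable under inclusion. -/
def ContainsAntichain {n : ℕ} (k : ℕ) (F : Finset (Finset (Fin n))) : Prop :=
  ∃ A : Finset (Finset (Fin n)),
    A ⊆ F ∧ A.card = k ∧ IsAntichain (· ⊆ ·) (A : Set (Finset (Fin n)))

/-- `F` is `k`-antichain saturated: it contains no antichain of size `k`, but adding any set
that is not yet in `F` creates one. -/
def AntichainSaturated {n : ℕ} (k : ℕ) (F : Finset (Finset (Fin n))) : Prop :=
  ¬ ContainsAntichain k F ∧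
    ∀ X : Finset (Fin n), X ∉ F → ContainsAntichain k (insert X F)

/-- The saturation number `sat*(n, k)`: the smallest size of a `k`-antichain saturated family
of subsets of an `n`-element set. -/
noncomputable def satStar (n k : ℕ) : ℕ :=
  sInf {m : ℕ | ∃ F : Finset (Finset (Fin n)), AntichainSaturated k F ∧ F.card = m}

/-- For `k ≥ 1` there is a `k`-antichain saturated family. -/
theorem exists_antichainSaturated (n : ℕ) {k : ℕ} (hk : 1 ≤ k) :
    ∃ F : Finset (Finset (Fin n)), AntichainSaturated k F := by
  have h0 : ¬ ContainsAntichain k (∅ : Finset (Finset (Fin n))) := by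
    rintro ⟨A, hA, hc, -⟩
    rw [Finset.subset_empty.mp hA, Finset.card_empty] at hc
    omega
  obtain ⟨F, hF⟩ := (Set.toFinite
    {F : Finset (Finset (Fin n)) | ¬ ContainsAntichain k F}).exists_maximal ⟨∅, h0⟩
  refine ⟨F, hF.prop, fun X hX => ?_⟩
  by_contra h
  exact hX (hF.le_of_ge h (Finset.subset_insert X F) (Finset.mem_insert_self X F))

/-- For `k ≥ 1` the infimum defining `satStar n k` is a minimum over a nonempty set. -/
theorem satStar_isLeast (n : ℕ) {k : ℕ} (hk : 1 ≤ k) :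
    IsLeast {m : ℕ | ∃ F : Finset (Finset (Fin n)), AntichainSaturated k F ∧ F.card = m}
      (satStar n k) := by
  obtain ⟨F, hF⟩ := exists_antichainSaturated n hk
  exact ⟨Nat.sInf_mem ⟨F.card, F, hF, rfl⟩, fun m hm => Nat.sInf_le hm⟩

/-! Put `w = k - 1`. A saturated family `F` has width at most `w`, and each missing set is
incomparable to a whole antichain of size `w` in `F`. If `n ≤ ℓ`, the cube itself has width at most
`w`, so nothing can be missing.

For `n > ℓ` the lower bound is proved layer by layer. The antichains of size `w` in `F` are closed
under join and meet: take the maximal or the minimal members of a union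
(`IsWideAntichain.maximals_minimals`). Let `L` be the lowest one. Its whole down-set lies in `F`,
and its members have size at most `ℓ / 2`, for otherwise its largest members could be replaced by
their shadow; dually, the members of the highest one have size at least `n - ℓ / 2`. Sets between
two consecutive such antichains also lie in `F`, and the Lehman–Ron linking theorem then raises an
antichain gradually, some members growing by one element at each push
(`IsWideAntichain.exists_push`). So each layer `j ≤ n - ℓ / 2` of `F` has, above `L`, at least as
many sets as `L` has members of size at most `j`. This gives `w` sets in each middle layer. For `j ≤
ℓ / 2`, Kruskal–Katona bounds the down-set of `L` from below, and both counts together give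
`ℓ.choose j`. Complementation handles the top layers.

Equality is attained by `thinFamily`: a cube on `ℓ` points, whose sets of the middle size `M` are
extended by initial segments of the other points, while smaller sets get none of those points and
larger sets get all of them. -/

/-! ### Hall's theorem through an intermediate layer -/

/-- Three-layer version of Hall's theorem: `ι`-indexed points are linked through distinct
intermediate vertices of `β` to distinct `ι`-indexed points. -/
theorem exists_disjoint_links {ι β : Type} [Fintype ι] [Fintype β] (A B : ι → β → Prop)
    (h : ∀ (K : Finset ι) (V : Finset β),
      (∀ u, (∃ i ∈ K, A i u) → (∃ j ∈ K, B j u) → u ∈ V) → K.card ≤ V.card) :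
    ∃ (u : ι → β) (σ : ι → ι), Function.Injective u ∧ Function.Injective σ ∧
      ∀ i, A i (u i) ∧ B (σ i) (u i) := by
  classical
  -- Vertex splitting: an intermediate `u` occurs on both sides, and matching it to itself means
  -- that it is unused. If some `i` takes the right copy of `u`, the left copy must go on to some
  -- `j`.
  let t : ι ⊕ β → Finset (β ⊕ ι) := Sum.elim
    (fun i => (Finset.univ.filter (A i)).map Function.Embedding.inl)
    (fun u => insert (Sum.inl u)
      ((Finset.univ.filter fun j => B j u).map Function.Embedding.inr))
  obtain ⟨f, hf, hft⟩ := (Finset.all_card_le_biUnion_card_iff_exists_injective t).1 (by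
    intro s
    let R := Finset.univ.filter fun i => Sum.inl i ∈ s
    let Q := Finset.univ.filter fun u => Sum.inr u ∈ s
    let AR := Finset.univ.filter fun u => ∃ i ∈ R, A i u
    let BQ := Finset.univ.filter fun j => ∃ u ∈ Q, B j u
    have hs : s = R.map Function.Embedding.inl ∪ Q.map Function.Embedding.inr := by
      ext z; cases z <;> simp [R, Q]
    have hsub : (AR ∪ Q).map Function.Embedding.inl ∪ BQ.map Function.Embedding.inr
        ⊆ s.biUnion t := by
      intro z hz
      rcases z with u | j
      · simp only [AR, R, Q, Finset.mem_union, Finset.mem_map, Finset.mem_filter,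
          Finset.mem_univ, true_and, Function.Embedding.inl_apply, Sum.inl.injEq,
          exists_eq_right, Function.Embedding.inr_apply, reduceCtorEq, and_false,
          exists_false, or_false] at hz
        rw [Finset.mem_biUnion]
        rcases hz with ⟨i, hi, hA⟩ | hu
        · exact ⟨_, hi, by simp [t, hA]⟩
        · exact ⟨_, hu, by simp [t]⟩
      · simp only [BQ, Q, Finset.mem_union, Finset.mem_map, Finset.mem_filter,
          Finset.mem_univ, true_and, Function.Embedding.inl_apply, reduceCtorEq, and_false,
          exists_false, false_or, Function.Embedding.inr_apply, Sum.inr.injEq,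
          exists_eq_right] at hz
        obtain ⟨u, hu, hB⟩ := hz
        rw [Finset.mem_biUnion]
        exact ⟨_, hu, by simp [t, hB]⟩
    have hdisj : ∀ {γ δ : Type} (X : Finset γ) (Y : Finset δ),
        (X.map (Function.Embedding.inl : γ ↪ γ ⊕ δ) ∪
          Y.map Function.Embedding.inr).card = X.card + Y.card := by
      intro γ δ X Y
      rw [Finset.card_union_of_disjoint, Finset.card_map, Finset.card_map]
      rw [Finset.disjoint_left]
      intro z hz hz'
      rw [Finset.mem_map] at hz hz'
      obtain ⟨a, -, rfl⟩ := hz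
      obtain ⟨b, -, hb⟩ := hz'
      simp at hb
    have h1 := Finset.card_le_card hsub
    rw [hdisj] at h1
    have h2 : s.card = R.card + Q.card := by rw [hs]; exact hdisj R Q
    -- A vertex linked from `R` to a point outside `BQ` cannot lie in `Q`, since `BQ` collects
    -- everything reached from `Q`.
    have h3 : (R \ BQ).card ≤ ((AR ∪ Q) \ Q).card := by
      refine h _ _ ?_
      rintro u ⟨i, hi, hA⟩ ⟨j, hj, hB⟩
      rw [Finset.mem_sdiff] at hi hj
      rw [Finset.mem_sdiff, Finset.mem_union]
      refine ⟨Or.inl (Finset.mem_filter.2 ⟨Finset.mem_univ _, i, hi.1, hA⟩), fun hu => ?_⟩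
      exact hj.2 (Finset.mem_filter.2 ⟨Finset.mem_univ _, u, hu, hB⟩)
    rw [Finset.card_sdiff_of_subset Finset.subset_union_right] at h3
    have h4 := Finset.le_card_sdiff BQ R
    have h5 : Q.card ≤ (AR ∪ Q).card := Finset.card_le_card Finset.subset_union_right
    omega)
  have hl : ∀ i, ∃ u, f (Sum.inl i) = Sum.inl u ∧ A i u := by
    intro i
    have := hft (Sum.inl i)
    simp only [t, Sum.elim_inl, Finset.mem_map, Finset.mem_filter, Finset.mem_univ,
      true_and] at this
    obtain ⟨u, hu, he⟩ := this
    exact ⟨u, he.symm, hu⟩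
  choose u hu hA using hl
  have hr : ∀ i, ∃ j, f (Sum.inr (u i)) = Sum.inr j ∧ B j (u i) := by
    intro i
    have := hft (Sum.inr (u i))
    simp only [t, Sum.elim_inr, Finset.mem_insert, Finset.mem_map, Finset.mem_filter,
      Finset.mem_univ, true_and] at this
    rcases this with h0 | ⟨j, hj, he⟩
    · have := hf (h0.trans (hu i).symm)
      simp at this
    · exact ⟨j, he.symm, hj⟩
  choose σ hσ hB using hr
  have hui : Function.Injective u := by
    intro i i' he
    exact Sum.inl_injective (hf (by rw [hu, hu, he]))
  refine ⟨u, σ, hui, ?_, fun i => ⟨hA i, hB i⟩⟩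
  intro i i' he
  exact hui (Sum.inr_injective (hf (by rw [hσ, hσ, he])))

/-! ### Double counting between two layers -/

section Linking

variable {α ι : Type} [Fintype α] [DecidableEq α] [Fintype ι]

open Classical in
/-- The sets of size `c` lying above some `x i` and below some `y j`. -/
noncomputable def betweenLayer (x y : ι → Finset α) (c : ℕ) : Finset (Finset α) :=
  Finset.univ.filter fun u => u.card = c ∧ (∃ i, x i ⊆ u) ∧ ∃ j, u ⊆ y j

theorem mem_betweenLayer {x y : ι → Finset α} {c : ℕ} {u : Finset α} :
    u ∈ betweenLayer x y c ↔ u.card = c ∧ (∃ i, x i ⊆ u) ∧ ∃ j, u ⊆ y j := by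
  simp [betweenLayer]

/-- Each `x i` below `u` is `u` minus one point `c`, and then `y j` minus `c` is counted above. A
point `e` of `y j` outside `u` gives one more set, since `y j` minus `e` still contains `u`. -/
theorem card_below_lt_card_above {x y : ι → Finset α} {a d : ℕ} (hx : Function.Injective x)
    (hxa : ∀ i, (x i).card = a) (hya : ∀ i, (y i).card = a + d + 2)
    {u : Finset α} (hu : u ∈ betweenLayer x y (a + 1)) {j : ι} (huj : u ⊆ y j) :
    (Finset.univ.filter fun i => x i ⊆ u).card <
      ((betweenLayer x y (a + d + 1)).filter fun v => v ⊆ y j).card := by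
  classical
  obtain ⟨huc, ⟨i₀, hi₀⟩, -⟩ := mem_betweenLayer.1 hu
  obtain ⟨e, he, heu⟩ := Finset.exists_mem_notMem_of_card_lt_card
    (show u.card < (y j).card by rw [huc, hya]; omega)
  let E := u.filter fun c => ∃ i, x i ⊆ u.erase c
  have h1 : (Finset.univ.filter fun i => x i ⊆ u).card ≤ E.card := by
    rw [← Finset.card_image_of_injective _ hx]
    refine (Finset.card_le_card (t := E.image u.erase) ?_).trans Finset.card_image_le
    intro z hz
    obtain ⟨i, hi, rfl⟩ := Finset.mem_image.1 hz
    have hi : x i ⊆ u := (Finset.mem_filter.1 hi).2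
    obtain ⟨c, hc, hcx⟩ := Finset.exists_mem_notMem_of_card_lt_card
      (show (x i).card < u.card by rw [huc, hxa]; omega)
    have hs : x i ⊆ u.erase c := Finset.subset_erase.2 ⟨hi, hcx⟩
    refine Finset.mem_image.2 ⟨c, Finset.mem_filter.2 ⟨hc, i, hs⟩, ?_⟩
    refine (Finset.eq_of_subset_of_card_le hs ?_).symm
    rw [Finset.card_erase_of_mem hc, huc, hxa]; rfl
  have h2 : (insert e E).card = E.card + 1 :=
    Finset.card_insert_of_notMem fun h => heu (Finset.mem_filter.1 h).1
  have hsub : insert e E ⊆ y j := by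
    intro c hc
    rcases Finset.mem_insert.1 hc with rfl | hc
    · exact he
    · exact huj (Finset.mem_filter.1 hc).1
  have h3 : (insert e E).card ≤
      ((betweenLayer x y (a + d + 1)).filter fun v => v ⊆ y j).card := by
    refine Finset.card_le_card_of_injOn (y j).erase ?_
      ((Finset.erase_injOn (y j)).mono (by exact_mod_cast hsub))
    intro c hc
    have hcy : c ∈ y j := hsub hc
    have hs : ∃ i, x i ⊆ (y j).erase c := by
      rcases Finset.mem_insert.1 hc with rfl | hc
      · exact ⟨i₀, hi₀.trans (Finset.subset_erase.2 ⟨huj, heu⟩)⟩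
      · obtain ⟨-, i, hi⟩ := Finset.mem_filter.1 hc
        exact ⟨i, hi.trans (Finset.erase_subset_erase _ huj)⟩
    rw [Finset.mem_coe, Finset.mem_filter]
    refine ⟨mem_betweenLayer.2 ⟨?_, hs, j, Finset.erase_subset _ _⟩, Finset.erase_subset _ _⟩
    rw [Finset.card_erase_of_mem hcy, hya]; rfl
  omega

/-- Hall's theorem assigns to the sets `u` of the lower layer distinct `y j` above them; the strict
local inequality is summed along this assignment. -/
theorem sum_card_above_lt_sum_card_below {x y : ι → Finset α} {a d : ℕ} [Nonempty ι]
    (hx : Function.Injective x) (hxa : ∀ i, (x i).card = a)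
    (hya : ∀ i, (y i).card = a + d + 2) (hxy : ∀ i, x i ⊆ y i)
    (hP : ∀ P' ⊆ betweenLayer x y (a + 1), ∀ J : Finset ι,
      (∀ u ∈ P', ∀ j, u ⊆ y j → j ∈ J) → P'.card ≤ J.card) :
    ∑ i, ((betweenLayer x y (a + 1)).filter fun u => x i ⊆ u).card <
      ∑ j, ((betweenLayer x y (a + d + 1)).filter fun v => v ⊆ y j).card := by
  classical
  set P := betweenLayer x y (a + 1)
  obtain ⟨g, hg, hgP⟩ := (Finset.all_card_le_biUnion_card_iff_exists_injective
    fun u : {u // u ∈ P} => Finset.univ.filter fun j => u.1 ⊆ y j).1 (by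
      intro s
      rw [← Finset.card_map (Function.Embedding.subtype _)]
      refine hP _ ?_ _ ?_
      · intro u hu
        obtain ⟨u, -, rfl⟩ := Finset.mem_map.1 hu
        exact u.2
      · intro u hu j hj
        obtain ⟨v, hv, rfl⟩ := Finset.mem_map.1 hu
        exact Finset.mem_biUnion.2 ⟨v, hv, by simpa using hj⟩)
  have hne : P.Nonempty := by
    obtain ⟨i⟩ := ‹Nonempty ι›
    obtain ⟨u, h1, h2, h3⟩ := Finset.exists_subsuperset_card_eq (n := a + 1) (hxy i)
      (by rw [hxa]; omega) (by rw [hya]; omega)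
    exact ⟨u, mem_betweenLayer.2 ⟨h3, ⟨i, h1⟩, i, h2⟩⟩
  have h1 : ∑ i, (P.filter fun u => x i ⊆ u).card =
      ∑ u ∈ P.attach, (Finset.univ.filter fun i => x i ⊆ u.1).card := by
    rw [Finset.sum_attach P fun u => (Finset.univ.filter fun i => x i ⊆ u).card]
    exact Finset.sum_card_bipartiteAbove_eq_sum_card_bipartiteBelow fun i u => x i ⊆ u
  rw [h1]
  calc _ < ∑ u ∈ P.attach,
        ((betweenLayer x y (a + d + 1)).filter fun v => v ⊆ y (g u)).card := by
        refine Finset.sum_lt_sum_of_nonempty (by simpa using hne) fun u _ => ?_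
        exact card_below_lt_card_above hx hxa hya u.2 (by simpa using hgP u)
    _ = ∑ j ∈ P.attach.map ⟨g, hg⟩,
        ((betweenLayer x y (a + d + 1)).filter fun v => v ⊆ y j).card := by
        rw [Finset.sum_map]; rfl
    _ ≤ _ := Finset.sum_le_sum_of_subset (Finset.subset_univ _)

theorem compl_mem_betweenLayer {x y : ι → Finset α} {c c' : ℕ}
    (hc : c + c' = Fintype.card α) {u : Finset α} :
    uᶜ ∈ betweenLayer (fun i => (y i)ᶜ) (fun i => (x i)ᶜ) c' ↔ u ∈ betweenLayer x y c := by
  have := Finset.card_compl_add_card u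
  simp only [mem_betweenLayer, Finset.compl_subset_compl]
  constructor
  · rintro ⟨h1, h2, h3⟩
    exact ⟨by omega, h3, h2⟩
  · rintro ⟨h1, h2, h3⟩
    exact ⟨by omega, h3, h2⟩

theorem sum_card_below_lt_sum_card_above {x y : ι → Finset α} {a d : ℕ} [Nonempty ι]
    (hy : Function.Injective y) (hxa : ∀ i, (x i).card = a)
    (hya : ∀ i, (y i).card = a + d + 2) (hxy : ∀ i, x i ⊆ y i)
    (hQ : ∀ Q' ⊆ betweenLayer x y (a + d + 1), ∀ J : Finset ι,
      (∀ u ∈ Q', ∀ j, x j ⊆ u → j ∈ J) → Q'.card ≤ J.card) :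
    ∑ j, ((betweenLayer x y (a + d + 1)).filter fun v => v ⊆ y j).card <
      ∑ i, ((betweenLayer x y (a + 1)).filter fun u => x i ⊆ u).card := by
  classical
  obtain ⟨i₀⟩ := id ‹Nonempty ι›
  have hn : a + d + 2 ≤ Fintype.card α := by rw [← hya i₀]; exact Finset.card_le_univ _
  have key := sum_card_above_lt_sum_card_below (x := fun i => (y i)ᶜ) (y := fun i => (x i)ᶜ)
    (a := Fintype.card α - (a + d + 2)) (d := d) (compl_injective.comp hy)
    (fun i => by rw [Finset.card_compl, hya])
    (fun i => by rw [Finset.card_compl, hxa]; omega)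
    (fun i => Finset.compl_subset_compl.2 (hxy i))
    (by
      intro P' hP' J hJ
      rw [← Finset.card_image_of_injective P' compl_injective]
      refine hQ _ ?_ J ?_
      · intro u hu
        obtain ⟨v, hv, rfl⟩ := Finset.mem_image.1 hu
        rw [← compl_mem_betweenLayer (c' := Fintype.card α - (a + d + 2) + 1) (by omega),
          compl_compl]
        exact hP' hv
      · intro u hu j hj
        obtain ⟨v, hv, rfl⟩ := Finset.mem_image.1 hu
        exact hJ v hv j (Finset.subset_compl_comm.1 hj))
  have e1 : ∀ j, ((betweenLayer x y (a + d + 1)).filter fun v => v ⊆ y j).card =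
      ((betweenLayer (fun i => (y i)ᶜ) (fun i => (x i)ᶜ)
        (Fintype.card α - (a + d + 2) + 1)).filter fun u => (y j)ᶜ ⊆ u).card := by
    intro j
    refine Finset.card_bij (fun v _ => vᶜ) ?_ (fun _ _ _ _ h => compl_injective h) ?_
    · intro v hv
      rw [Finset.mem_filter] at hv ⊢
      exact ⟨(compl_mem_betweenLayer (by omega)).2 hv.1, Finset.compl_subset_compl.2 hv.2⟩
    · intro v hv
      rw [Finset.mem_filter] at hv
      refine ⟨vᶜ, ?_, compl_compl v⟩
      rw [Finset.mem_filter, ← compl_mem_betweenLayer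
        (c' := Fintype.card α - (a + d + 2) + 1) (by omega), compl_compl]
      exact ⟨hv.1, compl_le_iff_compl_le.1 hv.2⟩
  have e2 : ∀ j, ((betweenLayer x y (a + 1)).filter fun u => x j ⊆ u).card =
      ((betweenLayer (fun i => (y i)ᶜ) (fun i => (x i)ᶜ)
        (Fintype.card α - (a + d + 2) + d + 1)).filter fun u => u ⊆ (x j)ᶜ).card := by
    intro j
    refine Finset.card_bij (fun v _ => vᶜ) ?_ (fun _ _ _ _ h => compl_injective h) ?_
    · intro v hv
      rw [Finset.mem_filter] at hv ⊢
      exact ⟨(compl_mem_betweenLayer (by omega)).2 hv.1, Finset.compl_subset_compl.2 hv.2⟩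
    · intro v hv
      rw [Finset.mem_filter] at hv
      refine ⟨vᶜ, ?_, compl_compl v⟩
      rw [Finset.mem_filter, ← compl_mem_betweenLayer
        (c' := Fintype.card α - (a + d + 2) + d + 1) (by omega), compl_compl]
      exact ⟨hv.1, Finset.subset_compl_comm.1 hv.2⟩
  simp only [e1, e2]
  exact key

end Linking

/-! ### The Lehman–Ron linking theorem and its version for antichains -/

/-- The Lehman–Ron theorem, in the form needed here: given matched families of sets in two
layers at distance at least two, the layers next to them contain linked families of the
same size. -/
theorem exists_links_adjacent_layers {α : Type} [Fintype α] [DecidableEq α] (d m : ℕ) :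
    ∀ (ι : Type) [Fintype ι] (x y : ι → Finset α) (a : ℕ), Fintype.card ι = m →
      Function.Injective x → Function.Injective y → (∀ i, (x i).card = a) →
      (∀ i, (y i).card = a + d + 2) → (∀ i, x i ⊆ y i) →
      (∃ u : ι → Finset α, Function.Injective u ∧
        ∀ i, (u i).card = a + 1 ∧ x i ⊆ u i ∧ ∃ j, u i ⊆ y j) ∧
      (∃ u : ι → Finset α, Function.Injective u ∧
        ∀ i, (u i).card = a + d + 1 ∧ x i ⊆ u i ∧ ∃ j, u i ⊆ y j) := by
  -- Outer induction on the gap, inner induction on the number of pairs. The inner one gives Hall's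
  -- condition for proper subfamilies, so only the size of the full intermediate layer is at stake.
  induction d using Nat.strong_induction_on generalizing m with
  | _ d ihd => ?_
  induction m using Nat.strong_induction_on with
  | _ m ihm => ?_
  intro ι _ x y a hm hx hy hxa hya hxy
  classical
  have hsub : ∀ c, c = a + 1 ∨ c = a + d + 1 → ∀ K : Finset ι, K ≠ Finset.univ →
      ∀ V : Finset (Finset α), (∀ u : Finset α, u.card = c → (∃ i ∈ K, x i ⊆ u) →
        (∃ j ∈ K, u ⊆ y j) → u ∈ V) → K.card ≤ V.card := by
    intro c hc K hK V hV
    have hlt : K.card < m := by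
      rw [← hm]; exact (Finset.card_lt_iff_ne_univ K).2 hK
    obtain ⟨h1, h2⟩ := ihm K.card hlt {i // i ∈ K} (fun i => x i) (fun i => y i) a (by simp)
      (hx.comp Subtype.val_injective) (hy.comp Subtype.val_injective)
      (fun i => hxa i) (fun i => hya i) (fun i => hxy i)
    have h3 : ∃ u : {i // i ∈ K} → Finset α, Function.Injective u ∧
        ∀ i, (u i).card = c ∧ x i ⊆ u i ∧ ∃ j : {i // i ∈ K}, u i ⊆ y j := by
      rcases hc with rfl | rfl
      · exact h1
      · exact h2
    obtain ⟨u, hu, h⟩ := h3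
    rw [← Finset.card_attach (s := K)]
    refine Finset.card_le_card_of_injOn u ?_ hu.injOn
    intro i _
    obtain ⟨e1, e2, j, e3⟩ := h i
    exact hV _ e1 ⟨i, i.2, e2⟩ ⟨j, j.2, e3⟩
  have hlink : ∀ c, c = a + 1 ∨ c = a + d + 1 → m ≤ (betweenLayer x y c).card →
      ∃ (u : ι → Finset α) (σ : ι → ι), Function.Injective u ∧ Function.Injective σ ∧
        ∀ i, ((u i).card = c ∧ x i ⊆ u i) ∧ u i ⊆ y (σ i) := by
    intro c hc hcard
    refine exists_disjoint_links (fun i u => u.card = c ∧ x i ⊆ u) (fun j u => u ⊆ y j) ?_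
    intro K V hV
    by_cases hK : K = Finset.univ
    · subst hK
      rw [Finset.card_univ, hm]
      refine hcard.trans (Finset.card_le_card fun u hu => ?_)
      obtain ⟨h1, ⟨i, hi⟩, j, hj⟩ := mem_betweenLayer.1 hu
      exact hV u ⟨i, Finset.mem_univ _, h1, hi⟩ ⟨j, Finset.mem_univ _, hj⟩
    · refine hsub c hc K hK V fun u hu hi hj => hV u ?_ hj
      obtain ⟨i, hi, hi'⟩ := hi
      exact ⟨i, hi, hu, hi'⟩
  -- If one of the two adjacent layers is large enough, linking through it narrows the gap, and the
  -- outer induction reaches the other.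
  by_cases hP : m ≤ (betweenLayer x y (a + 1)).card
  · obtain ⟨u, σ, hu, hσ, h⟩ := hlink _ (Or.inl rfl) hP
    refine ⟨⟨u, hu, fun i => ⟨(h i).1.1, (h i).1.2, _, (h i).2⟩⟩, ?_⟩
    rcases d with _ | d
    · exact ⟨u, hu, fun i => ⟨(h i).1.1, (h i).1.2, _, (h i).2⟩⟩
    · obtain ⟨-, v, hv, h'⟩ := ihd d (Nat.lt_succ_self d) m ι u (y ∘ σ) (a + 1) hm hu
        (hy.comp hσ) (fun i => (h i).1.1) (fun i => by rw [Function.comp, hya]; omega)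
        (fun i => (h i).2)
      refine ⟨v, hv, fun i => ⟨by rw [(h' i).1]; omega, (h i).1.2.trans (h' i).2.1, ?_⟩⟩
      obtain ⟨j, hj⟩ := (h' i).2.2
      exact ⟨σ j, hj⟩
  by_cases hQ : m ≤ (betweenLayer x y (a + d + 1)).card
  · obtain ⟨u, σ, hu, hσ, h⟩ := hlink _ (Or.inr rfl) hQ
    refine ⟨?_, ⟨u, hu, fun i => ⟨(h i).1.1, (h i).1.2, _, (h i).2⟩⟩⟩
    rcases d with _ | d
    · exact ⟨u, hu, fun i => ⟨(h i).1.1, (h i).1.2, _, (h i).2⟩⟩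
    · obtain ⟨⟨v, hv, h'⟩, -⟩ := ihd d (Nat.lt_succ_self d) m ι x u a hm hx
        hu hxa (fun i => by rw [(h i).1.1]; omega) (fun i => (h i).1.2)
      refine ⟨v, hv, fun i => ⟨(h' i).1, (h' i).2.1, ?_⟩⟩
      obtain ⟨j, hj⟩ := (h' i).2.2
      exact ⟨σ j, hj.trans (h j).2⟩
  -- If both layers have fewer than `m` sets, the two double counts give opposite strict
  -- inequalities. Their Hall conditions come from `hsub` applied to the complement of `J`.
  exfalso
  rw [not_le] at hP hQ
  have : Nonempty ι := by
    rw [← Fintype.card_pos_iff]; omega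
  refine lt_asymm (sum_card_above_lt_sum_card_below hx hxa hya hxy ?_)
    (sum_card_below_lt_sum_card_above hy hxa hya hxy ?_)
  · intro P' hP' J hJ
    by_cases hJ0 : Jᶜ = Finset.univ
    · rw [Finset.compl_eq_univ_iff] at hJ0
      subst hJ0
      rw [Finset.card_empty, Nat.le_zero, Finset.card_eq_zero, Finset.eq_empty_iff_forall_notMem]
      intro u hu
      obtain ⟨-, -, j, hj⟩ := mem_betweenLayer.1 (hP' hu)
      simpa using hJ u hu j hj
    · have := hsub _ (Or.inl rfl) Jᶜ hJ0 (betweenLayer x y (a + 1) \ P') (by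
        rintro u h1 ⟨i, -, hi⟩ ⟨j, hj, hj'⟩
        rw [Finset.mem_sdiff]
        refine ⟨mem_betweenLayer.2 ⟨h1, ⟨i, hi⟩, j, hj'⟩, fun hu => ?_⟩
        exact Finset.mem_compl.1 hj (hJ u hu j hj'))
      rw [Finset.card_compl, Finset.card_sdiff_of_subset hP', hm] at this
      have h1 := Finset.card_le_card hP'
      have h2 := Finset.card_le_univ J
      omega
  · intro Q' hQ' J hJ
    by_cases hJ0 : Jᶜ = Finset.univ
    · rw [Finset.compl_eq_univ_iff] at hJ0
      subst hJ0
      rw [Finset.card_empty, Nat.le_zero, Finset.card_eq_zero, Finset.eq_empty_iff_forall_notMem]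
      intro u hu
      obtain ⟨-, ⟨j, hj⟩, -⟩ := mem_betweenLayer.1 (hQ' hu)
      simpa using hJ u hu j hj
    · have := hsub _ (Or.inr rfl) Jᶜ hJ0 (betweenLayer x y (a + d + 1) \ Q') (by
        rintro u h1 ⟨i, hi, hi'⟩ ⟨j, hj, hj'⟩
        rw [Finset.mem_sdiff]
        refine ⟨mem_betweenLayer.2 ⟨h1, ⟨i, hi'⟩, j, hj'⟩, fun hu => ?_⟩
        exact Finset.mem_compl.1 hi (hJ u hu i hi'))
      rw [Finset.card_compl, Finset.card_sdiff_of_subset hQ', hm] at this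
      have h1 := Finset.card_le_card hQ'
      have h2 := Finset.card_le_univ J
      omega

/-- If the sets `x i` of one layer are matched to the members of an antichain, then they can
be matched into the next layer below that antichain. -/
theorem exists_links_next_layer {α : Type} [Fintype α] [DecidableEq α] {ι : Type} [Fintype ι]
    {x : ι → Finset α} {a : ℕ} (hx : Function.Injective x) (hxa : ∀ i, (x i).card = a) :
    ∀ (N : ℕ) (y : ι → Finset α), ∑ i, (y i).card ≤ N → Function.Injective y →
      (∀ i j, y i ⊆ y j → i = j) → (∀ i, x i ⊂ y i) →
      ∃ u : ι → Finset α, Function.Injective u ∧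
        ∀ i, (u i).card = a + 1 ∧ x i ⊆ u i ∧ ∃ j, u i ⊆ y j := by
  classical
  intro N
  induction N with
  | zero =>
    intro y hN _ _ hxy
    have : IsEmpty ι := ⟨fun i => by
      have h1 := Finset.card_lt_card (hxy i)
      have h2 : (y i).card ≤ ∑ i, (y i).card :=
        Finset.single_le_sum (f := fun i => (y i).card) (fun _ _ => Nat.zero_le _) (Finset.mem_univ i)
      omega⟩
    exact ⟨x, hx, fun i => isEmptyElim i⟩
  | succ N ih =>
    intro y hN hy hanti hxy
    by_cases hall : ∀ i, (y i).card = a + 1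
    · exact ⟨y, hy, fun i => ⟨hall i, (hxy i).subset, i, subset_rfl⟩⟩
    push Not at hall
    obtain ⟨i₀, hi₀⟩ := hall
    obtain ⟨i₁, -, hi₁⟩ := Finset.exists_max_image Finset.univ (fun i => (y i).card)
      ⟨i₀, Finset.mem_univ _⟩
    have hlt : ∀ i, a < (y i).card := fun i => by
      rw [← hxa i]; exact Finset.card_lt_card (hxy i)
    obtain ⟨d, hd⟩ : ∃ d, (y i₁).card = a + d + 2 := by
      have h1 := hlt i₀
      have h2 := hi₁ i₀ (Finset.mem_univ _)
      exact ⟨(y i₁).card - a - 2, by omega⟩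
    obtain ⟨-, v, hv, hvl⟩ := exists_links_adjacent_layers d _ {i // (y i).card = a + d + 2}
      (fun i => x i) (fun i => y i) a rfl (hx.comp Subtype.val_injective)
      (hy.comp Subtype.val_injective) (fun i => hxa i) (fun i => i.2)
      (fun i => (hxy i).subset)
    -- Only the largest `y i` are lowered, by one layer. The result is still an antichain, because
    -- an unchanged set inside a lowered one would lie inside some largest `y k`.
    let y' : ι → Finset α := fun i => if h : (y i).card = a + d + 2 then v ⟨i, h⟩ else y i
    have hpos : ∀ i (h : (y i).card = a + d + 2), y' i = v ⟨i, h⟩ := fun i h => dif_pos h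
    have hneg : ∀ i, (y i).card ≠ a + d + 2 → y' i = y i := fun i h => dif_neg h
    have hle : ∀ i, (y i).card ≤ a + d + 2 := fun i => by
      rw [← hd]; exact hi₁ i (Finset.mem_univ _)
    have hanti' : ∀ i j, y' i ⊆ y' j → i = j := by
      intro i j hij
      by_cases h1 : (y i).card = a + d + 2 <;> by_cases h2 : (y j).card = a + d + 2
      · rw [hpos i h1, hpos j h2] at hij
        have := hv (Finset.eq_of_subset_of_card_le hij (by rw [(hvl _).1, (hvl _).1]))
        simpa using this
      · rw [hpos i h1, hneg j h2] at hij
        obtain ⟨e1, -, k, e2⟩ := hvl ⟨i, h1⟩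
        have h3 := Finset.eq_of_subset_of_card_le hij (by rw [e1]; have := hle j; omega)
        rw [h3] at e2
        have := hanti _ _ e2
        subst this
        exact absurd k.2 h2
      · rw [hneg i h1, hpos j h2] at hij
        obtain ⟨e1, -, k, e2⟩ := hvl ⟨j, h2⟩
        have := hanti _ _ (hij.trans e2)
        subst this
        exact absurd k.2 h1
      · rw [hneg i h1, hneg j h2] at hij
        exact hanti _ _ hij
    have hcard : ∀ i, (y' i).card ≤ (y i).card := by
      intro i
      by_cases h : (y i).card = a + d + 2
      · rw [hpos i h, (hvl _).1, h]; omega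
      · rw [hneg i h]
    obtain ⟨u, hu, hul⟩ := ih y' (by
        have : ∑ i, (y' i).card < ∑ i, (y i).card := by
          refine Finset.sum_lt_sum (fun i _ => hcard i) ⟨i₁, Finset.mem_univ _, ?_⟩
          rw [hpos i₁ hd, (hvl _).1, hd]; omega
        omega)
      (fun i j h => hanti' i j h.subset) hanti' (by
        intro i
        by_cases h : (y i).card = a + d + 2
        · rw [hpos i h]
          refine ssubset_of_subset_of_ne (hvl ⟨i, h⟩).2.1 fun he => ?_
          have h1 := (hvl ⟨i, h⟩).1
          rw [← he, hxa] at h1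
          omega
        · rw [hneg i h]; exact hxy i)
    refine ⟨u, hu, fun i => ⟨(hul i).1, (hul i).2.1, ?_⟩⟩
    obtain ⟨j, hj⟩ := (hul i).2.2
    by_cases h : (y j).card = a + d + 2
    · rw [hpos j h] at hj
      obtain ⟨k, hk⟩ := (hvl ⟨j, h⟩).2.2
      exact ⟨k, hj.trans hk⟩
    · rw [hneg j h] at hj
      exact ⟨j, hj⟩

/-! ### The lattice of maximum antichains and pushing upward -/

section WideAntichains

variable {α : Type}

/-- `A` is an antichain of size `w` inside `F`. -/
structure IsWideAntichain (F : Finset (Finset α)) (w : ℕ) (A : Finset (Finset α)) : Prop where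
  subset : A ⊆ F
  antichain : IsAntichain (· ⊆ ·) (A : Set (Finset α))
  card_eq : A.card = w

/-- `F` has width at most `w`, and every set outside `F` is incomparable to all members of some
antichain of size `w` in `F`. -/
structure IsWidthSaturated (F : Finset (Finset α)) (w : ℕ) : Prop where
  card_le : ∀ A ⊆ F, IsAntichain (· ⊆ ·) (A : Set (Finset α)) → A.card ≤ w
  exists_incomparable : ∀ X ∉ F, ∃ A, IsWideAntichain F w A ∧ ∀ a ∈ A, ¬ a ⊆ X ∧ ¬ X ⊆ a

/-- Every member of `A` is contained in a member of `B`. -/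
def Refines (A B : Finset (Finset α)) : Prop := ∀ a ∈ A, ∃ b ∈ B, a ⊆ b

variable {F : Finset (Finset α)} {w : ℕ} {A B R S : Finset (Finset α)}

theorem Refines.trans {C : Finset (Finset α)} (h : Refines A B) (h' : Refines B C) :
    Refines A C := by
  intro a ha
  obtain ⟨b, hb, hab⟩ := h a ha
  obtain ⟨c, hc, hbc⟩ := h' b hb
  exact ⟨c, hc, hab.trans hbc⟩

theorem IsWideAntichain.eq (hA : IsWideAntichain F w A) {a b : Finset α} (ha : a ∈ A)
    (hb : b ∈ A) (h : a ⊆ b) : a = b := hA.antichain.eq ha hb h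

theorem Refines.antisymm (hA : IsWideAntichain F w A) (hB : IsWideAntichain F w B)
    (h : Refines A B) (h' : Refines B A) : A = B := by
  have key : ∀ {A B : Finset (Finset α)}, IsWideAntichain F w A → Refines A B →
      Refines B A → A ⊆ B := by
    intro A B hA h h' a ha
    obtain ⟨b, hb, hab⟩ := h a ha
    obtain ⟨a', ha', hba⟩ := h' b hb
    have := hA.eq ha ha' (hab.trans hba)
    subst this
    rwa [Finset.Subset.antisymm hab hba]
  exact Finset.Subset.antisymm (key hA h h') (key hB h' h)

variable [DecidableEq α]

theorem IsWideAntichain.exists_comparable (hF : IsWidthSaturated F w)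
    (hA : IsWideAntichain F w A) {X : Finset α} (hX : X ∈ F) : ∃ a ∈ A, a ⊆ X ∨ X ⊆ a := by
  by_contra! h
  have hXA : X ∉ A := fun hXA => (h X hXA).1 subset_rfl
  have := hF.card_le (insert X A) (Finset.insert_subset hX hA.subset) (by
    rw [Finset.coe_insert, isAntichain_insert]
    exact ⟨hA.antichain, fun b hb _ => ⟨(h b hb).2, (h b hb).1⟩⟩)
  rw [Finset.card_insert_of_notMem hXA, hA.card_eq] at this
  omega

/-- Antichains of size `w` are maximal in `F`, so `b` is comparable to a member of `A`; if it lies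
below one, the antichain property of `B` forces equality. Refinement can thus be read from either
end. -/
theorem Refines.flip (hF : IsWidthSaturated F w) (hA : IsWideAntichain F w A)
    (hB : IsWideAntichain F w B) (h : Refines A B) {b : Finset α} (hb : b ∈ B) :
    ∃ a ∈ A, a ⊆ b := by
  obtain ⟨a, ha, hab | hba⟩ := hA.exists_comparable hF (hB.subset hb)
  · exact ⟨a, ha, hab⟩
  · obtain ⟨b', hb', hab'⟩ := h a ha
    have := hB.eq hb hb' (hba.trans hab')
    subst this
    exact ⟨a, ha, hab'⟩

theorem refines_of_flip (hF : IsWidthSaturated F w) (hA : IsWideAntichain F w A)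
    (hB : IsWideAntichain F w B) (h : ∀ b ∈ B, ∃ a ∈ A, a ⊆ b) : Refines A B := by
  intro a ha
  obtain ⟨b, hb, hba | hab⟩ := hB.exists_comparable hF (hA.subset ha)
  · obtain ⟨a', ha', hab'⟩ := h b hb
    have := hA.eq ha' ha (hab'.trans hba)
    subst this
    exact ⟨b, hb, hab'⟩
  · exact ⟨b, hb, hab⟩

-- The maximal and minimal members together cover `A ∪ B`, and both include `A ∩ B`. Their sizes
-- therefore add up to at least `2 * w`, while the width bounds each by `w`.
open Classical in
theorem IsWideAntichain.maximals_minimals (hF : IsWidthSaturated F w)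
    (hA : IsWideAntichain F w A) (hB : IsWideAntichain F w B) :
    IsWideAntichain F w ((A ∪ B).filter (Maximal (· ∈ A ∪ B))) ∧
      IsWideAntichain F w ((A ∪ B).filter (Minimal (· ∈ A ∪ B))) := by
  set M := (A ∪ B).filter (Maximal (· ∈ A ∪ B)) with hM
  set N := (A ∪ B).filter (Minimal (· ∈ A ∪ B)) with hN
  have hsub : A ∪ B ⊆ F := Finset.union_subset hA.subset hB.subset
  have hMF : M ⊆ F := (Finset.filter_subset _ _).trans hsub
  have hNF : N ⊆ F := (Finset.filter_subset _ _).trans hsub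
  have hMa : IsAntichain (· ⊆ ·) (M : Set (Finset α)) := by
    intro a ha b hb hab h
    rw [Finset.mem_coe, hM, Finset.mem_filter] at ha hb
    exact hab (ha.2.eq_of_le hb.1 h)
  have hNa : IsAntichain (· ⊆ ·) (N : Set (Finset α)) := by
    intro a ha b hb hab h
    rw [Finset.mem_coe, hN, Finset.mem_filter] at ha hb
    exact hab (hb.2.eq_of_ge ha.1 h).symm
  have hinter : A ∩ B ⊆ M ∩ N := by
    intro a ha
    rw [Finset.mem_inter] at ha
    have hu : a ∈ A ∪ B := Finset.mem_union_left _ ha.1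
    rw [Finset.mem_inter, hM, hN, Finset.mem_filter, Finset.mem_filter]
    refine ⟨⟨hu, hu, fun b hb hab => ?_⟩, ⟨hu, hu, fun b hb hab => ?_⟩⟩
    · rcases Finset.mem_union.1 hb with hb | hb
      · exact (hA.eq ha.1 hb hab).ge
      · exact (hB.eq ha.2 hb hab).ge
    · rcases Finset.mem_union.1 hb with hb | hb
      · exact (hA.eq hb ha.1 hab).ge
      · exact (hB.eq hb ha.2 hab).ge
  have hunion : A ∪ B ⊆ M ∪ N := by
    intro a ha
    by_contra hcon
    rw [Finset.mem_union, not_or, hM, hN, Finset.mem_filter, Finset.mem_filter] at hcon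
    have h1 : ¬ Maximal (· ∈ A ∪ B) a := fun h => hcon.1 ⟨ha, h⟩
    have h2 : ¬ Minimal (· ∈ A ∪ B) a := fun h => hcon.2 ⟨ha, h⟩
    rw [not_maximal_iff ha] at h1
    rw [not_minimal_iff ha] at h2
    obtain ⟨b, hb, hab⟩ := h1
    obtain ⟨c, hc, hca⟩ := h2
    have hcb : c < b := lt_trans hca hab
    have key : ∀ {C : Finset (Finset α)} {s t : Finset α}, IsWideAntichain F w C →
        s ∈ C → t ∈ C → s < t → False := fun hC hs ht hst =>
      hst.ne (hC.eq hs ht hst.le)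
    rcases Finset.mem_union.1 ha with ha | ha <;> rcases Finset.mem_union.1 hb with hb | hb <;>
      rcases Finset.mem_union.1 hc with hc | hc
    · exact key hA ha hb hab
    · exact key hA ha hb hab
    · exact key hA hc ha hca
    · exact key hB hc hb hcb
    · exact key hA hc hb hcb
    · exact key hB hc ha hca
    · exact key hB ha hb hab
    · exact key hB ha hb hab
  have e1 := Finset.card_union_add_card_inter A B
  have e2 := Finset.card_union_add_card_inter M N
  have e3 := Finset.card_le_card hinter
  have e4 := Finset.card_le_card hunion
  have e5 := hF.card_le M hMF hMa
  have e6 := hF.card_le N hNF hNa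
  rw [hA.card_eq, hB.card_eq] at e1
  exact ⟨⟨hMF, hMa, by omega⟩, ⟨hNF, hNa, by omega⟩⟩

/-- Sets between two consecutive antichains of maximum size belong to the family. -/
theorem mem_of_between_consecutive (hF : IsWidthSaturated F w) (hR : IsWideAntichain F w R)
    (hS : IsWideAntichain F w S) (hRS : Refines R S)
    (hcons : ∀ C, IsWideAntichain F w C → Refines R C → Refines C S → C = R ∨ C = S)
    {r s X : Finset α} (hr : r ∈ R) (hs : s ∈ S) (hrX : r ⊆ X) (hXs : X ⊆ s) : X ∈ F := by
  classical
  by_contra hX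
  obtain ⟨A, hA, hAX⟩ := hF.exists_incomparable X hX
  -- Join with `R`, then meet with `S`: the result stays incomparable to `X` and lands between `R`
  -- and `S`. It must be one of these, yet `X` is comparable to `r` and to `s`.
  set C := (A ∪ R).filter (Maximal (· ∈ A ∪ R)) with hCdef
  have hC : IsWideAntichain F w C := (hA.maximals_minimals hF hR).1
  have hCX : ∀ c ∈ C, ¬ c ⊆ X ∧ ¬ X ⊆ c := by
    intro c hc
    rw [hCdef, Finset.mem_filter] at hc
    rcases Finset.mem_union.1 hc.1 with hcA | hcR
    · exact hAX c hcA
    · refine ⟨fun h => ?_, fun h => ?_⟩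
      · obtain ⟨a, ha, hac | hca⟩ := hA.exists_comparable hF (hR.subset hcR)
        · exact (hAX a ha).1 (hac.trans h)
        · have := hc.2.eq_of_le (Finset.mem_union_left _ ha) hca
          subst this
          exact (hAX _ ha).1 h
      · have h1 := hR.eq hr hcR (hrX.trans h)
        subst h1
        exact hX (Finset.Subset.antisymm h hrX ▸ hR.subset hr)
  have hRC : Refines R C := by
    intro a ha
    obtain ⟨b, hab, hb⟩ := (A ∪ R).exists_le_maximal (Finset.mem_union_right _ ha)
    exact ⟨b, Finset.mem_filter.2 ⟨hb.prop, hb⟩, hab⟩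
  set D := (C ∪ S).filter (Minimal (· ∈ C ∪ S)) with hDdef
  have hD : IsWideAntichain F w D := (hC.maximals_minimals hF hS).2
  have hDX : ∀ c ∈ D, ¬ c ⊆ X ∧ ¬ X ⊆ c := by
    intro c hc
    rw [hDdef, Finset.mem_filter] at hc
    rcases Finset.mem_union.1 hc.1 with hcC | hcS
    · exact hCX c hcC
    · refine ⟨fun h => ?_, fun h => ?_⟩
      · have h1 := hS.eq hcS hs (h.trans hXs)
        subst h1
        exact hX (Finset.Subset.antisymm h hXs ▸ hS.subset hs)
      · obtain ⟨a, ha, hac | hca⟩ := hC.exists_comparable hF (hS.subset hcS)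
        · have := hc.2.eq_of_ge (Finset.mem_union_left _ ha) hac
          subst this
          exact (hCX _ ha).2 h
        · exact (hCX a ha).2 (h.trans hca)
  have hDS : Refines D S := by
    refine refines_of_flip hF hD hS fun a ha => ?_
    obtain ⟨b, hab, hb⟩ := (C ∪ S).exists_le_minimal (Finset.mem_union_right _ ha)
    exact ⟨b, Finset.mem_filter.2 ⟨hb.prop, hb⟩, hab⟩
  have hRD : Refines R D := by
    refine refines_of_flip hF hR hD fun c hc => ?_
    rw [hDdef, Finset.mem_filter] at hc
    rcases Finset.mem_union.1 hc.1 with hcC | hcS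
    · exact hRC.flip hF hR hC hcC
    · exact hRS.flip hF hR hS hcS
  rcases hcons D hD hRD hDS with h | h
  · exact (hDX r (h ▸ hr)).1 hrX
  · exact (hDX s (h ▸ hs)).2 hXs

/-- Hall's condition holds between two antichains of maximum size. -/
theorem Refines.exists_injection (hF : IsWidthSaturated F w) (hR : IsWideAntichain F w R)
    (hS : IsWideAntichain F w S) (hRS : Refines R S) :
    ∃ f : {r // r ∈ R} → Finset α, Function.Injective f ∧ ∀ r, f r ∈ S ∧ r.1 ⊆ f r := by
  obtain ⟨f, hf, hf'⟩ := (Finset.all_card_le_biUnion_card_iff_exists_injective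
    fun r : {r // r ∈ R} => S.filter fun s => r.1 ⊆ s).1 (by
      intro T
      set V := T.biUnion fun r : {r // r ∈ R} => S.filter fun s => r.1 ⊆ s with hV
      set T' := T.map (Function.Embedding.subtype _) with hT'
      have hT'R : ∀ t ∈ T', t ∈ R := by
        intro t ht
        obtain ⟨t, -, rfl⟩ := Finset.mem_map.1 ht
        exact t.2
      have hVS : V ⊆ S := Finset.biUnion_subset.2 fun _ _ => Finset.filter_subset _ _
      have hVmem : ∀ t ∈ T', ∀ s ∈ S, t ⊆ s → s ∈ V := by
        intro t ht s hs hts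
        obtain ⟨t', ht', rfl⟩ := Finset.mem_map.1 ht
        exact Finset.mem_biUnion.2 ⟨t', ht', Finset.mem_filter.2 ⟨hs, hts⟩⟩
      have hno : ∀ s ∈ S \ V, ∀ t ∈ T', ¬ t ⊆ s ∧ ¬ s ⊆ t := by
        intro s hs t ht
        rw [Finset.mem_sdiff] at hs
        have h1 : ¬ t ⊆ s := fun h => hs.2 (hVmem t ht s hs.1 h)
        refine ⟨h1, fun h => ?_⟩
        obtain ⟨r, hr, hrs⟩ := hRS.flip hF hR hS hs.1
        have := hR.eq hr (hT'R t ht) (hrs.trans h)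
        subst this
        exact h1 hrs
      -- Trading the neighbours `V` for `T'` gives an antichain again, so the width bound is Hall's
      -- inequality.
      have hcard := hF.card_le (S \ V ∪ T') (Finset.union_subset
        (Finset.sdiff_subset.trans hS.subset) fun t ht => hR.subset (hT'R t ht)) (by
          intro a ha b hb hab h
          rw [Finset.mem_coe, Finset.mem_union] at ha hb
          rcases ha with ha | ha <;> rcases hb with hb | hb
          · exact hab (hS.eq (Finset.mem_sdiff.1 ha).1 (Finset.mem_sdiff.1 hb).1 h)
          · exact (hno a ha b hb).2 h
          · exact (hno b hb a ha).1 h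
          · exact hab (hR.eq (hT'R a ha) (hT'R b hb) h))
      rw [Finset.card_union_of_disjoint (Finset.disjoint_left.2 fun s hs ht =>
        (hno s hs s ht).1 subset_rfl), Finset.card_sdiff_of_subset hVS, hT', Finset.card_map,
        hS.card_eq] at hcard
      have := Finset.card_le_card hVS
      rw [hS.card_eq] at this
      omega)
  exact ⟨f, hf, fun r => Finset.mem_filter.1 (hf' r)⟩

variable [Fintype α]

/-- An antichain of maximum size that is not the top one can be pushed up: some of its members,
all of the same size, are replaced by as many sets that are larger by one element. -/
theorem IsWideAntichain.exists_push (hF : IsWidthSaturated F w) (hR : IsWideAntichain F w R)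
    (hS : IsWideAntichain F w S) (hRS : Refines R S) (hne : R ≠ S) :
    ∃ (T U : Finset (Finset α)) (a : ℕ), T ⊆ R ∧ T.Nonempty ∧ (∀ t ∈ T, t.card = a) ∧
      (∀ u ∈ U, u.card = a + 1) ∧ U.card = T.card ∧ (∀ u ∈ U, ∃ t ∈ T, t ⊆ u) ∧
      Disjoint (R \ T) U ∧ IsWideAntichain F w (R \ T ∪ U) := by
  classical
  -- a least antichain above `R`
  obtain ⟨S, hS', hSmin⟩ := Finset.exists_min_image
    (Finset.univ.filter fun S => IsWideAntichain F w S ∧ Refines R S ∧ R ≠ S)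
    (fun S => (Finset.univ.filter fun X : Finset α => ∃ s ∈ S, X ⊆ s).card)
    ⟨S, by simp [hS, hRS, hne]⟩
  simp only [Finset.mem_filter, Finset.mem_univ, true_and] at hS' hSmin
  clear hS hRS hne
  obtain ⟨hS, hRS, hne⟩ := hS'
  have hcons : ∀ C, IsWideAntichain F w C → Refines R C → Refines C S → C = R ∨ C = S := by
    intro C hC hRC hCS
    by_contra! h
    have hle := hSmin C ⟨hC, hRC, h.1.symm⟩
    have hsub : (Finset.univ.filter fun X : Finset α => ∃ s ∈ C, X ⊆ s) ⊆
        Finset.univ.filter fun X : Finset α => ∃ s ∈ S, X ⊆ s := by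
      intro X hX
      simp only [Finset.mem_filter, Finset.mem_univ, true_and] at hX ⊢
      obtain ⟨c, hc, hXc⟩ := hX
      obtain ⟨s, hs, hcs⟩ := hCS c hc
      exact ⟨s, hs, hXc.trans hcs⟩
    have heq := Finset.eq_of_subset_of_card_le hsub hle
    refine h.2 (hCS.antisymm hC hS fun s hs => ?_)
    have : s ∈ Finset.univ.filter fun X : Finset α => ∃ s ∈ C, X ⊆ s := by
      rw [heq]
      exact Finset.mem_filter.2 ⟨Finset.mem_univ _, s, hs, subset_rfl⟩
    simpa using this
  have hRSne : (R \ S).Nonempty := by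
    rw [Finset.nonempty_iff_ne_empty, Ne, Finset.sdiff_eq_empty_iff_subset]
    intro h
    exact hne (Finset.eq_of_subset_of_card_le h (by rw [hR.card_eq, hS.card_eq]))
  -- Minimal size matters: a retained set strictly below a new one would have size at most `a`, and
  -- would already belong to `T` or to `S`.
  obtain ⟨r₀, hr₀, hmin⟩ := Finset.exists_min_image (R \ S) Finset.card hRSne
  set a := r₀.card
  set T := (R \ S).filter fun t => t.card = a with hT
  have hTR : ∀ t ∈ T, t ∈ R ∧ t ∉ S ∧ t.card = a := by
    intro t ht
    rw [hT, Finset.mem_filter, Finset.mem_sdiff] at ht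
    exact ⟨ht.1.1, ht.1.2, ht.2⟩
  obtain ⟨f, hf, hfS⟩ := hRS.exists_injection hF hR hS
  obtain ⟨u, hu, hul⟩ := exists_links_next_layer (ι := {t // t ∈ T}) (x := fun t => t.1)
    Subtype.val_injective (fun t => (hTR t t.2).2.2) _
    (fun t => f ⟨t.1, (hTR t t.2).1⟩) le_rfl
    (fun t t' h => Subtype.ext (Subtype.mk.inj (hf h)))
    (fun t t' h => by
      have := hf (hS.eq (hfS _).1 (hfS _).1 h)
      exact Subtype.ext (Subtype.mk.inj this))
    (fun t => ssubset_of_subset_of_ne (hfS ⟨t.1, (hTR t t.2).1⟩).2 fun h => (hTR t t.2).2.1 (by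
      have := (hfS ⟨t.1, (hTR t t.2).1⟩).1
      rwa [← h] at this))
  set U := Finset.univ.image u with hU
  have hUT : ∀ v ∈ U, v.card = a + 1 ∧ (∃ t ∈ T, t ⊆ v) ∧ ∃ s ∈ S, v ⊆ s := by
    intro v hv
    obtain ⟨t, -, rfl⟩ := Finset.mem_image.1 hv
    obtain ⟨h1, h2, j, h3⟩ := hul t
    exact ⟨h1, ⟨t, t.2, h2⟩, _, (hfS _).1, h3⟩
  have hUcard : U.card = T.card := by
    rw [hU, Finset.card_image_of_injective _ hu, Finset.card_univ, Fintype.card_coe]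
  have hno : ∀ r ∈ R \ T, ∀ v ∈ U, ¬ r ⊆ v ∧ ¬ v ⊆ r := by
    intro r hr v hv
    rw [Finset.mem_sdiff] at hr
    obtain ⟨hvc, ⟨t, ht, htv⟩, s, hs, hvs⟩ := hUT v hv
    obtain ⟨htR, -, htc⟩ := hTR t ht
    have h1 : ¬ v ⊆ r := by
      intro h
      have := hR.eq htR hr.1 (htv.trans h)
      subst this
      exact hr.2 ht
    refine ⟨fun h => ?_, h1⟩
    by_cases hrS : r ∈ S
    · have := hS.eq hrS hs (h.trans hvs)
      subst this
      exact h1 hvs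
    · have h2 := hmin r (Finset.mem_sdiff.2 ⟨hr.1, hrS⟩)
      have h3 : r.card < v.card := Finset.card_lt_card
        (ssubset_of_subset_of_ne h fun h' => h1 h'.ge)
      refine hr.2 ?_
      rw [hT, Finset.mem_filter, Finset.mem_sdiff]
      exact ⟨⟨hr.1, hrS⟩, by omega⟩
  have hdisj : Disjoint (R \ T) U :=
    Finset.disjoint_left.2 fun r hr hr' => (hno r hr r hr').1 subset_rfl
  have hTsub : T ⊆ R := fun t ht => (hTR t ht).1
  refine ⟨T, U, a, hTsub, ⟨r₀, ?_⟩, fun t ht => (hTR t ht).2.2, fun v hv => (hUT v hv).1,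
    hUcard, fun v hv => (hUT v hv).2.1, hdisj, ⟨?_, ?_, ?_⟩⟩
  · rw [hT, Finset.mem_filter]; exact ⟨hr₀, rfl⟩
  · refine Finset.union_subset (Finset.sdiff_subset.trans hR.subset) fun v hv => ?_
    obtain ⟨-, ⟨t, ht, htv⟩, s, hs, hvs⟩ := hUT v hv
    exact mem_of_between_consecutive hF hR hS hRS hcons (hTsub ht) hs htv hvs
  · intro p hp q hq hpq h
    rw [Finset.mem_coe, Finset.mem_union] at hp hq
    rcases hp with hp | hp <;> rcases hq with hq | hq
    · exact hpq (hR.eq (Finset.mem_sdiff.1 hp).1 (Finset.mem_sdiff.1 hq).1 h)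
    · exact (hno p hp q hq).1 h
    · exact (hno q hq p hp).2 h
    · exact hpq (Finset.eq_of_subset_of_card_le h
        (by rw [(hUT p hp).1, (hUT q hq).1]))
  · rw [Finset.card_union_of_disjoint hdisj, hUcard, Finset.card_sdiff_of_subset hTsub,
      hR.card_eq]
    have := Finset.card_le_card hTsub
    rw [hR.card_eq] at this
    omega

/-- Pushing an antichain up through layer `j` leaves a trace in that layer. -/
theorem IsWideAntichain.card_filter_le_card_layer (hF : IsWidthSaturated F w) {j : ℕ}
    (hterm : ∀ R, IsWideAntichain F w R →
      (∀ S, IsWideAntichain F w S → Refines R S → R = S) → ∀ r ∈ R, j ≤ r.card)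
    (hR : IsWideAntichain F w R) :
    (R.filter fun r => r.card ≤ j).card ≤
      (F.filter fun X => X.card = j ∧ ∃ r ∈ R, r ⊆ X).card := by
  classical
  -- Each push increases the total size of the members, which cannot exceed `w * Fintype.card α`;
  -- `N` bounds the remaining room.
  suffices h : ∀ (N : ℕ) (R : Finset (Finset α)), IsWideAntichain F w R →
      w * Fintype.card α ≤ N + ∑ r ∈ R, r.card →
      (R.filter fun r => r.card ≤ j).card ≤
        (F.filter fun X => X.card = j ∧ ∃ r ∈ R, r ⊆ X).card from
    h (w * Fintype.card α) R hR (Nat.le_add_right _ _)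
  clear hR
  intro N
  induction N with
  | zero => ?_
  | succ N ih => ?_
  all_goals
    intro R hR hN
    by_cases htop : ∀ S, IsWideAntichain F w S → Refines R S → R = S
    · refine Finset.card_le_card fun r hr => ?_
      rw [Finset.mem_filter] at hr ⊢
      exact ⟨hR.subset hr.1, le_antisymm hr.2 (hterm R hR htop r hr.1), r, hr.1, subset_rfl⟩
    push Not at htop
    obtain ⟨S, hS, hRS, hne⟩ := htop
    obtain ⟨T, U, a, hTR, hTne, hTa, hUa, hUT, hUabove, hdisj, hQ⟩ :=
      hR.exists_push hF hS hRS hne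
    have hsumT : ∑ t ∈ T, t.card = T.card * a := by
      rw [Finset.sum_congr rfl hTa, Finset.sum_const, smul_eq_mul]
    have hsumU : ∑ t ∈ U, t.card = T.card * (a + 1) := by
      rw [Finset.sum_congr rfl hUa, Finset.sum_const, smul_eq_mul, hUT]
    have hsum : ∑ r ∈ R \ T ∪ U, r.card = ∑ r ∈ R, r.card + T.card := by
      rw [Finset.sum_union hdisj, ← Finset.sum_sdiff hTR, hsumT, hsumU]; ring
    have hTpos := hTne.card_pos
  · have : ∑ r ∈ R \ T ∪ U, r.card ≤ (R \ T ∪ U).card * Fintype.card α :=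
      Finset.sum_le_card_nsmul _ _ _ fun r _ => Finset.card_le_univ r
    rw [hQ.card_eq] at this
    omega
  · have hI := ih _ hQ (by omega)
    have hup : ∀ X, (∃ r ∈ R \ T ∪ U, r ⊆ X) → ∃ r ∈ R, r ⊆ X := by
      rintro X ⟨r, hr, hrX⟩
      rcases Finset.mem_union.1 hr with hr | hr
      · exact ⟨r, (Finset.mem_sdiff.1 hr).1, hrX⟩
      · obtain ⟨t, ht, htr⟩ := hUabove r hr
        exact ⟨t, hTR ht, htr.trans hrX⟩
    have e1 : ((R \ T ∪ U).filter fun r => r.card ≤ j).card =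
        ((R \ T).filter fun r => r.card ≤ j).card + (U.filter fun r => r.card ≤ j).card := by
      rw [Finset.filter_union, Finset.card_union_of_disjoint
        (Finset.disjoint_filter_filter hdisj)]
    have e2 : (R.filter fun r => r.card ≤ j).card =
        ((R \ T).filter fun r => r.card ≤ j).card + (T.filter fun r => r.card ≤ j).card := by
      rw [← Finset.card_union_of_disjoint (Finset.disjoint_filter_filter
        Finset.sdiff_disjoint), ← Finset.filter_union, Finset.sdiff_union_of_subset hTR]
    have hmono : (F.filter fun X => X.card = j ∧ ∃ r ∈ R \ T ∪ U, r ⊆ X) ⊆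
        F.filter fun X => X.card = j ∧ ∃ r ∈ R, r ⊆ X := by
      intro X hX
      rw [Finset.mem_filter] at hX ⊢
      exact ⟨hX.1, hX.2.1, hup X hX.2.2⟩
    have hTc : (T.filter fun r => r.card ≤ j).card = if a ≤ j then T.card else 0 := by
      split_ifs with h
      · rw [Finset.filter_true_of_mem fun t ht => by rw [hTa t ht]; exact h]
      · rw [Finset.filter_false_of_mem fun t ht => by rw [hTa t ht]; exact h,
          Finset.card_empty]
    have hUc : (U.filter fun r => r.card ≤ j).card = if a + 1 ≤ j then T.card else 0 := by
      split_ifs with h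
      · rw [Finset.filter_true_of_mem fun t ht => by rw [hUa t ht]; exact h, hUT]
      · rw [Finset.filter_false_of_mem fun t ht => by rw [hUa t ht]; exact h,
          Finset.card_empty]
    -- Only a push out of layer `j` changes the number of members of size at most `j`. It loses `T`,
    -- but `T` lies in layer `j` of `F` and above no member of the new antichain.
    by_cases haj : a = j
    · subst haj
      have hdis : Disjoint (F.filter fun X => X.card = a ∧ ∃ r ∈ R \ T ∪ U, r ⊆ X) T := by
        rw [Finset.disjoint_left]
        intro X hX hXT
        obtain ⟨-, -, r, hr, hrX⟩ := Finset.mem_filter.1 hX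
        rcases Finset.mem_union.1 hr with hr | hr
        · rw [Finset.mem_sdiff] at hr
          have := hR.eq hr.1 (hTR hXT) hrX
          subst this
          exact hr.2 hXT
        · have h1 := Finset.card_le_card hrX
          rw [hUa r hr, hTa X hXT] at h1
          omega
      have hle := Finset.card_le_card (Finset.union_subset hmono
        (show T ⊆ F.filter fun X => X.card = a ∧ ∃ r ∈ R, r ⊆ X from fun t ht =>
          Finset.mem_filter.2 ⟨hR.subset (hTR ht), hTa t ht, t, hTR ht, subset_rfl⟩))
      rw [Finset.card_union_of_disjoint hdis] at hle
      rw [if_pos le_rfl] at hTc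
      rw [if_neg (by omega)] at hUc
      omega
    · have hle := Finset.card_le_card hmono
      have : (if a ≤ j then T.card else 0) = if a + 1 ≤ j then T.card else 0 := by
        split_ifs <;> omega
      omega

end WideAntichains

/-! ### Shadows in the lower half of the cube -/

section KruskalKatona

open Finset.Colex

theorem exists_initSeg_subset {n r : ℕ} (P : Finset (Finset (Fin n))) (hP : IsInitSeg P r)
    {c : ℕ} (hc : c ≤ P.card) : ∃ C ⊆ P, IsInitSeg C r ∧ C.card = c := by
  induction h : P.card - c generalizing P with
  | zero => exact ⟨P, subset_rfl, hP, by omega⟩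
  | succ N ih =>
    obtain ⟨M, hM, hmax⟩ := Finset.exists_max_image P toColex (by
      rw [← Finset.card_pos]; omega)
    have hcard := Finset.card_erase_of_mem hM
    obtain ⟨C, hCP, hC, hCc⟩ := ih (P.erase M)
      ⟨fun s hs => hP.1 (Finset.mem_of_mem_erase hs), fun s t hs ht => by
        refine Finset.mem_erase.2 ⟨?_, hP.2 (Finset.mem_of_mem_erase hs) ht⟩
        rintro rfl
        exact absurd (hmax s (Finset.mem_of_mem_erase hs)) (not_le_of_gt ht.1)⟩
      (by omega) (by omega)
    exact ⟨C, hCP.trans (Finset.erase_subset _ _), hC, hCc⟩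

theorem isInitSeg_powersetCard {n l r : ℕ} (hl : l < n) :
    IsInitSeg (Finset.powersetCard r (Finset.Iio (⟨l, hl⟩ : Fin n))) r := by
  refine ⟨fun s hs => (Finset.mem_powersetCard.1 hs).2, fun s t hs ht => ?_⟩
  rw [Finset.mem_powersetCard] at hs ⊢
  refine ⟨fun b hb => ?_, ht.2⟩
  rw [Finset.mem_Iio]
  exact forall_lt_mono ht.1.le (fun b hb => Finset.mem_Iio.1 (hs.1 hb)) b hb

/-- In the lower half of the cube, the shadow loses at most as many sets as the family. -/
theorem choose_le_card_shadow_add {n l r f : ℕ} (hl : l < n) (hr : 1 ≤ r) (hrl : 2 * r ≤ l + 1)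
    {G : Finset (Finset (Fin n))} (hG : (G : Set (Finset (Fin n))).Sized r)
    (hcard : l.choose r ≤ G.card + f) : l.choose (r - 1) ≤ G.shadow.card + f := by
  set I := Finset.Iio (⟨l, hl⟩ : Fin n) with hI
  have hIc : I.card = l := by simp [hI]
  have hPc : (Finset.powersetCard r I).card = l.choose r := by
    rw [Finset.card_powersetCard, hIc]
  obtain ⟨C, hCP, hC, hCc⟩ := exists_initSeg_subset _ (isInitSeg_powersetCard (r := r) hl)
    (c := l.choose r - f) (by rw [hPc]; omega)
  have hkk := Finset.kruskal_katona hG (by omega) hC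
  -- Among subsets of `I`, each `(r - 1)`-set missing from the shadow of `C` has all its `l - (r -
  -- 1) ≥ r` extensions outside `C`, and an `r`-set contains only `r` such sets. So the shadow
  -- misses no more sets than `C` does.
  have hdc := Finset.card_mul_le_card_mul (fun s t : Finset (Fin n) => s ⊆ t)
    (s := Finset.powersetCard (r - 1) I \ C.shadow) (t := Finset.powersetCard r I \ C)
    (m := l - (r - 1)) (n := r) (by
      intro s hs
      rw [Finset.mem_sdiff, Finset.mem_powersetCard] at hs
      have h1 : (I \ s).card = l - (r - 1) := by
        rw [Finset.card_sdiff_of_subset hs.1.1, hIc, hs.1.2]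
      rw [← h1]
      refine Finset.card_le_card_of_injOn (fun e => insert e s) ?_ ?_
      · intro e he
        rw [Finset.mem_coe, Finset.mem_sdiff] at he
        rw [Finset.mem_coe, Finset.mem_bipartiteAbove, Finset.mem_sdiff,
          Finset.mem_powersetCard]
        refine ⟨⟨⟨Finset.insert_subset he.1 hs.1.1, ?_⟩, fun hmem => hs.2 ?_⟩,
          Finset.subset_insert _ _⟩
        · rw [Finset.card_insert_of_notMem he.2, hs.1.2]; omega
        · rw [Finset.mem_shadow_iff]
          exact ⟨_, hmem, e, Finset.mem_insert_self _ _, Finset.erase_insert he.2⟩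
      · intro e he e' _ h
        rw [Finset.mem_coe, Finset.mem_sdiff] at he
        have h2 : e ∈ insert e' s := by
          rw [← show insert e s = insert e' s from h]; exact Finset.mem_insert_self _ _
        exact (Finset.mem_insert.1 h2).resolve_right he.2)
    (by
      intro t ht
      rw [Finset.mem_sdiff, Finset.mem_powersetCard] at ht
      calc _ ≤ (Finset.powersetCard (r - 1) t).card := by
            refine Finset.card_le_card fun s hs => ?_
            rw [Finset.mem_bipartiteBelow, Finset.mem_sdiff, Finset.mem_powersetCard] at hs
            exact Finset.mem_powersetCard.2 ⟨hs.2, hs.1.1.2⟩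
        _ = r := by
            obtain ⟨r, rfl⟩ := Nat.exists_eq_add_of_le' hr
            rw [Finset.card_powersetCard, ht.1.2, Nat.add_sub_cancel, Nat.choose_succ_self_right])
  have hle : (Finset.powersetCard (r - 1) I \ C.shadow).card ≤
      (Finset.powersetCard r I \ C).card := by
    refine Nat.le_of_mul_le_mul_right (c := r) ((Nat.mul_le_mul_left _ ?_).trans hdc) hr
    omega
  rw [Finset.card_sdiff_of_subset hCP, hPc] at hle
  have h3 := Finset.le_card_sdiff C.shadow (Finset.powersetCard (r - 1) I)
  rw [Finset.card_powersetCard, hIc] at h3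
  omega

/-- A family of `s`-sets whose size is at most `(2s-1).choose s` is not larger than its
shadow. -/
theorem card_le_card_shadow_of_card_le_choose {n s : ℕ} (hs : 1 ≤ s)
    {G : Finset (Finset (Fin n))} (hG : (G : Set (Finset (Fin n))).Sized s)
    (hcard : G.card ≤ (2 * s - 1).choose s) : G.card ≤ G.shadow.card := by
  by_cases hn : 2 * s - 1 < n
  · have hsym : (2 * s - 1).choose (s - 1) = (2 * s - 1).choose s :=
      Nat.choose_symm_of_eq_add (by omega)
    have := choose_le_card_shadow_add (f := (2 * s - 1).choose s - G.card) hn hs (by omega) hG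
      (by omega)
    omega
  -- In a ground set of at most `2 * s - 1` points, the local LYM inequality suffices.
  · have h := Finset.card_mul_le_card_shadow_mul hG
    rw [Fintype.card_fin] at h
    exact Nat.le_of_mul_le_mul_right (h.trans (Nat.mul_le_mul_left _ (by omega))) hs

end KruskalKatona

/-! ### The lowest maximum antichain -/

section LowestAntichain

variable {n : ℕ} {F : Finset (Finset (Fin n))} {w : ℕ} {L : Finset (Finset (Fin n))}

/-- Minimize the size of the generated down-set: a refinement has a smaller or equal down-set, and
equality forces refinement both ways. -/
theorem exists_lowest_wideAntichain (h : ∃ A, IsWideAntichain F w A) :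
    ∃ L, IsWideAntichain F w L ∧ ∀ A, IsWideAntichain F w A → Refines A L → A = L := by
  classical
  obtain ⟨A, hA⟩ := h
  obtain ⟨L, hL, hLmin⟩ := Finset.exists_min_image
    (Finset.univ.filter fun S => IsWideAntichain F w S)
    (fun S => (Finset.univ.filter fun X : Finset (Fin n) => ∃ s ∈ S, X ⊆ s).card)
    ⟨A, by simp [hA]⟩
  simp only [Finset.mem_filter, Finset.mem_univ, true_and] at hL hLmin
  refine ⟨L, hL, fun A hA hAL => hAL.antisymm hA hL fun s hs => ?_⟩
  have hsub : (Finset.univ.filter fun X : Finset (Fin n) => ∃ s ∈ A, X ⊆ s) ⊆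
      Finset.univ.filter fun X : Finset (Fin n) => ∃ s ∈ L, X ⊆ s := by
    intro X hX
    simp only [Finset.mem_filter, Finset.mem_univ, true_and] at hX ⊢
    obtain ⟨c, hc, hXc⟩ := hX
    obtain ⟨s, hs, hcs⟩ := hAL c hc
    exact ⟨s, hs, hXc.trans hcs⟩
  have heq := Finset.eq_of_subset_of_card_le hsub (hLmin A hA)
  have : s ∈ Finset.univ.filter fun X : Finset (Fin n) => ∃ s ∈ A, X ⊆ s := by
    rw [heq]
    exact Finset.mem_filter.2 ⟨Finset.mem_univ _, s, hs, subset_rfl⟩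
  simpa using this

/-- If `X` were missing, its witness `A` could be met with `L`. By minimality the meet is `L`, so
`a` lies below a member of `A`, and hence so does `X`. -/
theorem mem_of_subset_lowest (hF : IsWidthSaturated F w) (hL : IsWideAntichain F w L)
    (hmin : ∀ A, IsWideAntichain F w A → Refines A L → A = L) {a X : Finset (Fin n)}
    (ha : a ∈ L) (hX : X ⊆ a) : X ∈ F := by
  classical
  by_contra hXF
  obtain ⟨A, hA, hAX⟩ := hF.exists_incomparable X hXF
  set N := (A ∪ L).filter (Minimal (· ∈ A ∪ L)) with hNdef
  have hN : IsWideAntichain F w N := (hA.maximals_minimals hF hL).2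
  have hex : ∀ b ∈ A ∪ L, ∃ c ∈ N, c ⊆ b := by
    intro b hb
    obtain ⟨c, hcb, hc⟩ := (A ∪ L).exists_le_minimal hb
    exact ⟨c, Finset.mem_filter.2 ⟨hc.prop, hc⟩, hcb⟩
  have hNL : N = L := hmin N hN
    (refines_of_flip hF hN hL fun b hb => hex b (Finset.mem_union_right _ hb))
  have hLA : Refines L A := refines_of_flip hF hL hA fun b hb => by
    have := hex b (Finset.mem_union_left _ hb)
    rwa [hNL] at this
  obtain ⟨b, hb, hab⟩ := hLA a ha
  exact (hAX b hb).2 (hX.trans hab)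

/-- If the largest size `s` exceeded `l / 2`, then `l ≤ 2 * s - 1`, so the members of size `s` would
have a shadow at least as large as themselves. Replacing them by it would give a strictly lower
antichain of size `w`. -/
theorem card_le_half_of_mem_lowest {l : ℕ} (hF : IsWidthSaturated F w)
    (hL : IsWideAntichain F w L)
    (hmin : ∀ A, IsWideAntichain F w A → Refines A L → A = L) (hw : w = l.choose (l / 2))
    {a : Finset (Fin n)} (ha : a ∈ L) : a.card ≤ l / 2 := by
  classical
  obtain ⟨b, hb, hmax⟩ := Finset.exists_max_image L Finset.card ⟨a, ha⟩
  refine (hmax a ha).trans ?_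
  by_contra! hlt
  set s := b.card with hs
  set T := L.filter fun t => t.card = s with hT
  have hTL : T ⊆ L := Finset.filter_subset _ _
  have hTs : (T : Set (Finset (Fin n))).Sized s := fun t ht => (Finset.mem_filter.1 ht).2
  have hTw : T.card ≤ w := by
    rw [← hL.card_eq]; exact Finset.card_le_card hTL
  have hws : w ≤ (2 * s - 1).choose s := by
    have h1 : (2 * s - 1).choose ((2 * s - 1) / 2) = (2 * s - 1).choose s :=
      Nat.choose_symm_of_eq_add (by omega)
    rw [hw, ← h1]
    exact (Nat.choose_le_choose _ (by omega)).trans (Nat.choose_le_middle _ _)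
  have hsh := card_le_card_shadow_of_card_le_choose (by omega) hTs (hTw.trans hws)
  have hshmem : ∀ v ∈ T.shadow, v.card + 1 = s ∧ ∃ t ∈ T, v ⊆ t := by
    intro v hv
    rw [Finset.mem_shadow_iff] at hv
    obtain ⟨t, ht, c, hc, rfl⟩ := hv
    refine ⟨?_, t, ht, Finset.erase_subset _ _⟩
    rw [Finset.card_erase_add_one hc]; exact hTs ht
  have hno : ∀ r ∈ L \ T, ∀ v ∈ T.shadow, ¬ r ⊆ v ∧ ¬ v ⊆ r := by
    intro r hr v hv
    rw [Finset.mem_sdiff] at hr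
    obtain ⟨hvc, t, ht, hvt⟩ := hshmem v hv
    have h1 : ¬ r ⊆ v := by
      intro h
      have := hL.eq hr.1 (hTL ht) (h.trans hvt)
      subst this
      exact hr.2 ht
    refine ⟨h1, fun h => h1 ?_⟩
    have h2 := hmax r hr.1
    have h3 : r.card ≠ s := fun h => hr.2 (Finset.mem_filter.2 ⟨hr.1, h⟩)
    exact (Finset.eq_of_subset_of_card_le h (by omega)).ge
  have hdisj : Disjoint (L \ T) T.shadow :=
    Finset.disjoint_left.2 fun r hr hr' => (hno r hr r hr').1 subset_rfl
  have hsubF : L \ T ∪ T.shadow ⊆ F := by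
    refine Finset.union_subset (Finset.sdiff_subset.trans hL.subset) fun v hv => ?_
    obtain ⟨-, t, ht, hvt⟩ := hshmem v hv
    exact mem_of_subset_lowest hF hL hmin (hTL ht) hvt
  have hanti : IsAntichain (· ⊆ ·) ((L \ T ∪ T.shadow : Finset _) : Set (Finset (Fin n))) := by
    intro p hp q hq hpq h
    rw [Finset.mem_coe, Finset.mem_union] at hp hq
    rcases hp with hp | hp <;> rcases hq with hq | hq
    · exact hpq (hL.eq (Finset.mem_sdiff.1 hp).1 (Finset.mem_sdiff.1 hq).1 h)
    · exact (hno p hp q hq).1 h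
    · exact (hno q hq p hp).2 h
    · have h1 := (hshmem p hp).1
      have h2 := (hshmem q hq).1
      exact hpq (Finset.eq_of_subset_of_card_le h (by omega))
  have hcard : (L \ T ∪ T.shadow).card = w := by
    refine le_antisymm (hF.card_le _ hsubF hanti) ?_
    rw [Finset.card_union_of_disjoint hdisj, Finset.card_sdiff_of_subset hTL, hL.card_eq]
    omega
  have heq := hmin _ ⟨hsubF, hanti, hcard⟩ (by
    intro p hp
    rcases Finset.mem_union.1 hp with hp | hp
    · exact ⟨p, (Finset.mem_sdiff.1 hp).1, subset_rfl⟩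
    · obtain ⟨-, t, ht, hpt⟩ := hshmem p hp
      exact ⟨t, hTL ht, hpt⟩)
  have hbT : b ∈ T := Finset.mem_filter.2 ⟨hb, rfl⟩
  rw [← heq] at hb
  rcases Finset.mem_union.1 hb with h | h
  · exact (Finset.mem_sdiff.1 h).2 hbT
  · have := (hshmem b h).1
    omega

/-- The down-set of the lowest antichain is large in every layer, up to the members of that
antichain in lower layers. -/
theorem choose_le_card_below_lowest {l j : ℕ} (hln : l < n) (hL : IsWideAntichain F w L)
    (hw : w = l.choose (l / 2)) (hsize : ∀ a ∈ L, a.card ≤ l / 2) (hj : j ≤ l / 2) :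
    l.choose j ≤ (Finset.univ.filter fun X : Finset (Fin n) =>
        X.card = j ∧ ∃ a ∈ L, X ⊆ a).card + (L.filter fun a => a.card < j).card := by
  classical
  induction hj using Nat.decreasingInduction with
  | self =>
    rw [← hw, ← hL.card_eq, ← Finset.card_filter_add_card_filter_not (s := L) (fun a => a.card < l / 2),
      add_comm]
    refine Nat.add_le_add_right (Finset.card_le_card fun a ha => ?_) _
    rw [Finset.mem_filter] at ha ⊢
    exact ⟨Finset.mem_univ _, le_antisymm (hsize a ha.1) (not_lt.1 ha.2), a, ha.1, subset_rfl⟩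
  | of_succ j hj ih =>
    set D := Finset.univ.filter fun X : Finset (Fin n) => X.card = j + 1 ∧ ∃ a ∈ L, X ⊆ a
      with hD
    have hDs : (D : Set (Finset (Fin n))).Sized (j + 1) := fun t ht =>
      (Finset.mem_filter.1 ht).2.1
    -- The allowed deficit is the number of members of `L` below the current layer. One layer down,
    -- the members of size `j` are new, as they avoid the shadow of `D`; the deficit drops
    -- accordingly.
    have h1 := choose_le_card_shadow_add hln (by omega) (by omega) hDs ih
    rw [Nat.add_sub_cancel] at h1
    have h2 : (L.filter fun a => a.card < j + 1).card =
        (L.filter fun a => a.card < j).card + (L.filter fun a => a.card = j).card := by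
      rw [← Finset.card_union_of_disjoint (Finset.disjoint_filter.2 fun a _ h h' => by omega),
        ← Finset.filter_or]
      congr 1
      ext a
      simp only [Finset.mem_filter, Nat.lt_succ_iff_lt_or_eq]
    have hdisj : Disjoint D.shadow (L.filter fun a => a.card = j) := by
      rw [Finset.disjoint_left]
      intro v hv hvL
      rw [Finset.mem_shadow_iff] at hv
      obtain ⟨t, ht, c, hc, rfl⟩ := hv
      obtain ⟨-, -, a, ha, hta⟩ := Finset.mem_filter.1 ht
      have := hL.eq (Finset.mem_filter.1 hvL).1 ha ((Finset.erase_subset _ _).trans hta)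
      rw [← this] at hta
      exact Finset.notMem_erase c t (hta hc)
    have h3 : (D.shadow ∪ L.filter fun a => a.card = j).card ≤
        (Finset.univ.filter fun X : Finset (Fin n) => X.card = j ∧ ∃ a ∈ L, X ⊆ a).card := by
      refine Finset.card_le_card fun v hv => ?_
      rw [Finset.mem_filter]
      refine ⟨Finset.mem_univ _, ?_⟩
      rcases Finset.mem_union.1 hv with hv | hv
      · rw [Finset.mem_shadow_iff] at hv
        obtain ⟨t, ht, c, hc, rfl⟩ := hv
        obtain ⟨-, htc, a, ha, hta⟩ := Finset.mem_filter.1 ht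
        refine ⟨?_, a, ha, (Finset.erase_subset _ _).trans hta⟩
        rw [Finset.card_erase_of_mem hc, htc]; rfl
      · rw [Finset.mem_filter] at hv
        exact ⟨hv.2, v, hv.1, subset_rfl⟩
    rw [Finset.card_union_of_disjoint hdisj] at h3
    omega

/-! ### Complementation and the lower bound layer by layer -/

open scoped FinsetFamily

theorem isAntichain_compls {A : Finset (Finset (Fin n))}
    (hA : IsAntichain (· ⊆ ·) (A : Set (Finset (Fin n)))) :
    IsAntichain (· ⊆ ·) ((Aᶜˢ : Finset _) : Set (Finset (Fin n))) := by
  intro a ha b hb hab h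
  rw [Finset.mem_coe, Finset.mem_compls] at ha hb
  exact hab (compl_injective (hA.eq hb ha (Finset.compl_subset_compl.2 h)).symm)

theorem IsWideAntichain.compls {A : Finset (Finset (Fin n))} (hA : IsWideAntichain F w A) :
    IsWideAntichain Fᶜˢ w Aᶜˢ :=
  ⟨Finset.compls_subset_compls.2 hA.subset, isAntichain_compls hA.antichain,
    by rw [Finset.card_compls, hA.card_eq]⟩

theorem IsWidthSaturated.compls (hF : IsWidthSaturated F w) : IsWidthSaturated Fᶜˢ w := by
  refine ⟨fun A hA hanti => ?_, fun X hX => ?_⟩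
  · rw [← Finset.card_compls]
    exact hF.card_le _ (Finset.compls_subset_iff.2 hA) (isAntichain_compls hanti)
  · rw [Finset.mem_compls] at hX
    obtain ⟨A, hA, hAX⟩ := hF.exists_incomparable _ hX
    refine ⟨Aᶜˢ, hA.compls, fun a ha => ?_⟩
    obtain ⟨h1, h2⟩ := hAX _ (Finset.mem_compls.1 ha)
    exact ⟨fun h => h2 (Finset.compl_subset_compl.2 h),
      fun h => h1 (Finset.compl_subset_compl.2 h)⟩

theorem card_ge_of_mem_highest {l : ℕ} (hF : IsWidthSaturated F w)
    (hw : w = l.choose (l / 2)) {R : Finset (Finset (Fin n))} (hR : IsWideAntichain F w R)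
    (hmax : ∀ S, IsWideAntichain F w S → Refines R S → R = S) {r : Finset (Fin n)}
    (hr : r ∈ R) : n ≤ r.card + l / 2 := by
  have h := card_le_half_of_mem_lowest (L := Rᶜˢ) (a := rᶜ) hF.compls hR.compls (by
    intro A hA hAR
    have hA' : IsWideAntichain F w Aᶜˢ := by
      have := hA.compls
      rwa [Finset.compls_compls] at this
    rw [hmax Aᶜˢ hA' fun s hs => ?_, Finset.compls_compls]
    obtain ⟨a, ha, hab⟩ := hAR.flip hF.compls hA hR.compls
      (b := sᶜ) (by rwa [Finset.mem_compls, compl_compl])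
    exact ⟨aᶜ, by rwa [Finset.mem_compls, compl_compl], Finset.subset_compl_comm.1 hab⟩) hw
    (by rwa [Finset.mem_compls, compl_compl])
  have := Finset.card_compl_add_card r
  rw [Fintype.card_fin] at this
  omega

/-- From level `l / 2` on, all of `L` leaves its trace in layer `j`. Below that, the sets under `L`
and the trace above `L` meet only in members of `L` of size `j`, so the members of `L` missing from
the downward count are made up by the upward one. -/
theorem IsWidthSaturated.choose_le_card_layer {l j : ℕ} (hF : IsWidthSaturated F w)
    (hne : ∃ A, IsWideAntichain F w A) (hw : w = l.choose (l / 2)) (hln : l < n) (hj : j + l / 2 ≤ n) :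
    l.choose (min j (l / 2)) ≤ (F.filter fun X => X.card = j).card := by
  classical
  obtain ⟨L, hL, hmin⟩ := exists_lowest_wideAntichain hne
  have hsize : ∀ a ∈ L, a.card ≤ l / 2 := fun a ha =>
    card_le_half_of_mem_lowest hF hL hmin hw ha
  have hup := hL.card_filter_le_card_layer hF (j := j) fun R hR hmax r hr => by
    have := card_ge_of_mem_highest hF hw hR hmax hr
    omega
  rcases le_total (l / 2) j with h | h
  · rw [min_eq_right h, ← hw, ← hL.card_eq]
    rw [Finset.filter_true_of_mem fun a ha => (hsize a ha).trans h] at hup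
    refine hup.trans (Finset.card_le_card fun X hX => ?_)
    rw [Finset.mem_filter] at hX ⊢
    exact ⟨hX.1, hX.2.1⟩
  · rw [min_eq_left h]
    have hdown := choose_le_card_below_lowest hln hL hw hsize h
    set D := Finset.univ.filter fun X : Finset (Fin n) => X.card = j ∧ ∃ a ∈ L, X ⊆ a
    set U := F.filter fun X => X.card = j ∧ ∃ r ∈ L, r ⊆ X
    have h1 : (D ∪ U).card ≤ (F.filter fun X => X.card = j).card := by
      refine Finset.card_le_card (Finset.union_subset (fun X hX => ?_) fun X hX => ?_)
      · obtain ⟨-, hXj, a, ha, hXa⟩ := Finset.mem_filter.1 hX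
        exact Finset.mem_filter.2 ⟨mem_of_subset_lowest hF hL hmin ha hXa, hXj⟩
      · obtain ⟨hXF, hXj, -⟩ := Finset.mem_filter.1 hX
        exact Finset.mem_filter.2 ⟨hXF, hXj⟩
    have h2 : (D ∩ U).card ≤ (L.filter fun a => a.card = j).card := by
      refine Finset.card_le_card fun X hX => ?_
      rw [Finset.mem_inter] at hX
      obtain ⟨-, hXj, a, ha, hXa⟩ := Finset.mem_filter.1 hX.1
      obtain ⟨-, -, r, hr, hrX⟩ := Finset.mem_filter.1 hX.2
      have := hL.eq hr ha (hrX.trans hXa)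
      subst this
      exact Finset.mem_filter.2 ⟨Finset.Subset.antisymm hrX hXa ▸ hr, hXj⟩
    have h3 : (L.filter fun a => a.card ≤ j).card =
        (L.filter fun a => a.card < j).card + (L.filter fun a => a.card = j).card := by
      rw [← Finset.card_union_of_disjoint (Finset.disjoint_filter.2 fun a _ h h' => by omega),
        ← Finset.filter_or]
      congr 1
      ext a
      simp only [Finset.mem_filter, le_iff_lt_or_eq]
    have h4 := Finset.card_union_add_card_inter D U
    omega

/-- A sum over all layers of an `n`-cube, split into the `m + 1` lowest, the `m + 1` highest and
the remaining layers. -/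
theorem sum_range_symmetric_split {n m : ℕ} (h : 2 * m + 1 ≤ n) (f : ℕ → ℕ) :
    ∑ j ∈ Finset.range (n + 1), f j = ∑ j ∈ Finset.range (m + 1), f j +
      (∑ i ∈ Finset.range (n - (2 * m + 1)), f (m + 1 + i) +
        ∑ j ∈ Finset.range (m + 1), f (n - j)) := by
  have e : n + 1 = (m + 1) + ((n - (2 * m + 1)) + (m + 1)) := by omega
  rw [e, Finset.sum_range_add f (m + 1), Finset.sum_range_add (fun i => f (m + 1 + i)), 
    ← Finset.sum_range_reflect (fun i => f (m + 1 + (n - (2 * m + 1) + i))) (m + 1)]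
  congr 2
  refine Finset.sum_congr rfl fun j hj => ?_
  rw [Finset.mem_range] at hj
  congr 1
  omega

theorem IsWidthSaturated.le_card {l : ℕ} (hF : IsWidthSaturated F w)
    (hne : ∃ A, IsWideAntichain F w A) (hw : w = l.choose (l / 2)) (hln : l < n) :
    2 * ∑ j ∈ Finset.range (l / 2 + 1), l.choose j + w * (n - (2 * (l / 2) + 1)) ≤ F.card := by
  classical
  have hsum : F.card = ∑ j ∈ Finset.range (n + 1), (F.filter fun X => X.card = j).card := by
    refine Finset.card_eq_sum_card_fiberwise fun X _ => ?_
    rw [Finset.mem_coe, Finset.mem_range, Nat.lt_succ_iff]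
    exact (Finset.card_le_univ X).trans_eq (Fintype.card_fin n)
  have hne' : ∃ A, IsWideAntichain Fᶜˢ w A := by
    obtain ⟨A, hA⟩ := hne
    exact ⟨_, hA.compls⟩
  rw [hsum, sum_range_symmetric_split (m := l / 2) (by omega)
    fun j => (F.filter fun X => X.card = j).card]
  have h1 : ∑ j ∈ Finset.range (l / 2 + 1), l.choose j ≤
      ∑ j ∈ Finset.range (l / 2 + 1), (F.filter fun X => X.card = j).card := by
    refine Finset.sum_le_sum fun j hj => ?_
    rw [Finset.mem_range] at hj
    have := hF.choose_le_card_layer hne hw hln (j := j) (by omega)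
    rwa [min_eq_left (by omega)] at this
  have h2 : w * (n - (2 * (l / 2) + 1)) ≤ ∑ i ∈ Finset.range (n - (2 * (l / 2) + 1)),
      (F.filter fun X => X.card = l / 2 + 1 + i).card := by
    rw [mul_comm]
    conv_lhs => rw [← Finset.card_range (n - (2 * (l / 2) + 1)), ← smul_eq_mul]
    refine Finset.card_nsmul_le_sum _ _ _ fun i hi => ?_
    rw [Finset.mem_range] at hi
    have := hF.choose_le_card_layer hne hw hln (j := l / 2 + 1 + i) (by omega)
    rwa [min_eq_right (by omega), ← hw] at this
  have h3 : ∑ j ∈ Finset.range (l / 2 + 1), l.choose j ≤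
      ∑ j ∈ Finset.range (l / 2 + 1), (F.filter fun X => X.card = n - j).card := by
    refine Finset.sum_le_sum fun j hj => ?_
    rw [Finset.mem_range] at hj
    have := hF.compls.choose_le_card_layer hne' hw hln (j := j) (by omega)
    rw [min_eq_left (by omega)] at this
    refine this.trans ?_
    rw [← Finset.card_compls]
    refine Finset.card_le_card fun X hX => ?_
    rw [Finset.mem_compls, Finset.mem_filter, Finset.mem_compls, compl_compl,
      Finset.card_compl, Fintype.card_fin] at hX
    have := Finset.card_le_univ X
    rw [Fintype.card_fin] at this
    exact Finset.mem_filter.2 ⟨hX.1, by omega⟩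
  omega

end LowestAntichain

/-! ### Saturation in terms of width, and the extremal family -/

section Extremal

variable {n : ℕ}

theorem AntichainSaturated.isWidthSaturated {w : ℕ} {F : Finset (Finset (Fin n))}
    (hF : AntichainSaturated (w + 1) F) : IsWidthSaturated F w := by
  refine ⟨fun A hA hanti => ?_, fun X hX => ?_⟩
  · by_contra! h
    obtain ⟨B, hBA, hB⟩ := Finset.exists_subset_card_eq h
    exact hF.1 ⟨B, hBA.trans hA, hB, hanti.subset (by exact_mod_cast hBA)⟩
  · obtain ⟨A, hA, hAc, hanti⟩ := hF.2 X hX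
    have hXA : X ∈ A := by
      by_contra hXA
      exact hF.1 ⟨A, (Finset.subset_insert_iff_of_notMem hXA).1 hA, hAc, hanti⟩
    refine ⟨A.erase X, ⟨Finset.subset_insert_iff.1 hA, hanti.subset (by simp), ?_⟩, ?_⟩
    · rw [Finset.card_erase_of_mem hXA, hAc]; rfl
    · intro a ha
      rw [Finset.mem_erase] at ha
      exact ⟨hanti ha.2 hXA ha.1, hanti hXA ha.2 ha.1.symm⟩

theorem IsWidthSaturated.antichainSaturated {w : ℕ} {F : Finset (Finset (Fin n))}
    (hF : IsWidthSaturated F w) : AntichainSaturated (w + 1) F := by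
  refine ⟨?_, fun X hX => ?_⟩
  · rintro ⟨A, hA, hAc, hanti⟩
    have := hF.card_le A hA hanti
    omega
  · obtain ⟨A, hA, hAX⟩ := hF.exists_incomparable X hX
    refine ⟨insert X A, Finset.insert_subset_insert X hA.subset, ?_, ?_⟩
    · rw [Finset.card_insert_of_notMem fun h => hX (hA.subset h), hA.card_eq]
    · rw [Finset.coe_insert, isAntichain_insert]
      exact ⟨hA.antichain, fun b hb _ => ⟨(hAX b hb).2, (hAX b hb).1⟩⟩

theorem IsWidthSaturated.exists_wideAntichain {w : ℕ} {F : Finset (Finset (Fin n))}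
    (hF : IsWidthSaturated F w) (hw : w ≤ n.choose (n / 2)) : ∃ A, IsWideAntichain F w A := by
  by_cases h : F = Finset.univ
  · obtain ⟨B, hB, hBc⟩ := Finset.exists_subset_card_eq
      (show w ≤ (Finset.powersetCard (n / 2) (Finset.univ : Finset (Fin n))).card by
        rwa [Finset.card_powersetCard, Finset.card_univ, Fintype.card_fin])
    refine ⟨B, h ▸ Finset.subset_univ B, fun a ha b hb hab hle => ?_, hBc⟩
    exact hab (Finset.eq_of_subset_of_card_le hle (by
      rw [(Finset.mem_powersetCard.1 (hB ha)).2, (Finset.mem_powersetCard.1 (hB hb)).2]))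
  · obtain ⟨X, hX⟩ : ∃ X, X ∉ F := by
      by_contra! h'
      exact h (Finset.eq_univ_iff_forall.2 h')
    obtain ⟨A, hA, -⟩ := hF.exists_incomparable X hX
    exact ⟨A, hA⟩

/-- The elements of `Fin n` below `c`. -/
def lowPart (n c : ℕ) : Finset (Fin n) := Finset.univ.filter fun x => (x : ℕ) < c

theorem mem_lowPart {c : ℕ} {x : Fin n} : x ∈ lowPart n c ↔ (x : ℕ) < c := by
  simp [lowPart]

theorem card_lowPart {c : ℕ} (hc : c ≤ n) : (lowPart n c).card = c := by
  rw [lowPart, Fin.card_filter_val_lt, min_eq_right hc]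

theorem lowPart_mono {c d : ℕ} (h : c ≤ d) : lowPart n c ⊆ lowPart n d := fun x hx => by
  rw [mem_lowPart] at hx ⊢
  omega

open Classical in
/-- The sets `X` whose part outside the first `l` points is an initial segment of the remaining
points, empty when `X` has fewer than `M` of the first `l` points, and everything when it has
more than `M`. -/
noncomputable def thinFamily (n l M : ℕ) : Finset (Finset (Fin n)) :=
  Finset.univ.filter fun X =>
    (∃ c, l ≤ c ∧ c ≤ n ∧ X \ lowPart n l = lowPart n c \ lowPart n l) ∧
    ((X ∩ lowPart n l).card < M → X ⊆ lowPart n l) ∧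
    (M < (X ∩ lowPart n l).card → (lowPart n l)ᶜ ⊆ X)

theorem mem_thinFamily {l M : ℕ} {X : Finset (Fin n)} : X ∈ thinFamily n l M ↔
    (∃ c, l ≤ c ∧ c ≤ n ∧ X \ lowPart n l = lowPart n c \ lowPart n l) ∧
    ((X ∩ lowPart n l).card < M → X ⊆ lowPart n l) ∧
    (M < (X ∩ lowPart n l).card → (lowPart n l)ᶜ ⊆ X) := by
  simp [thinFamily]

/-- Outside the first `l` points, a small trace leaves nothing and a large one everything. In the
remaining case both traces have size `M`, so they coincide, and the outer parts are nested initial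
segments. -/
theorem thinFamily_comparable {l M : ℕ} {X Y : Finset (Fin n)} (hX : X ∈ thinFamily n l M)
    (hY : Y ∈ thinFamily n l M) (h : X ∩ lowPart n l ⊆ Y ∩ lowPart n l) : X ⊆ Y ∨ Y ⊆ X := by
  rw [mem_thinFamily] at hX hY
  obtain ⟨⟨c, -, -, hc⟩, hX1, -⟩ := hX
  obtain ⟨⟨d, -, -, hd⟩, -, hY2⟩ := hY
  set I := lowPart n l
  have hsplit : ∀ {Z W : Finset (Fin n)}, Z ∩ I ⊆ W ∩ I → Z \ I ⊆ W \ I → Z ⊆ W := by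
    intro Z W h1 h2 x hx
    by_cases hxI : x ∈ I
    · exact (Finset.mem_inter.1 (h1 (Finset.mem_inter.2 ⟨hx, hxI⟩))).1
    · exact (Finset.mem_sdiff.1 (h2 (Finset.mem_sdiff.2 ⟨hx, hxI⟩))).1
  rcases lt_or_ge (X ∩ I).card M with h1 | h1
  · left
    exact hsplit h (by rw [Finset.sdiff_eq_empty_iff_subset.2 (hX1 h1)]; simp)
  rcases lt_or_ge M (Y ∩ I).card with h2 | h2
  · left
    refine hsplit h fun x hx => ?_
    rw [Finset.mem_sdiff] at hx ⊢
    exact ⟨hY2 h2 (Finset.mem_compl.2 hx.2), hx.2⟩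
  have he := Finset.eq_of_subset_of_card_le h (h2.trans h1)
  rcases le_total c d with hcd | hcd
  · left
    exact hsplit h (by rw [hc, hd]; exact Finset.sdiff_subset_sdiff (lowPart_mono hcd) subset_rfl)
  · right
    exact hsplit he.ge (by
      rw [hc, hd]; exact Finset.sdiff_subset_sdiff (lowPart_mono hcd) subset_rfl)

theorem card_le_of_isAntichain_of_subset_thinFamily {l M : ℕ} (hl : l ≤ n)
    {A : Finset (Finset (Fin n))} (hA : A ⊆ thinFamily n l M)
    (hanti : IsAntichain (· ⊆ ·) (A : Set (Finset (Fin n)))) :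
    A.card ≤ l.choose (l / 2) := by
  classical
  let t : Finset (Fin n) → Finset (Fin l) := fun X =>
    Finset.univ.filter fun i => Fin.castLE hl i ∈ X
  have key : ∀ X ∈ A, ∀ Y ∈ A, t X ⊆ t Y → X = Y := by
    intro X hX Y hY h
    have h' : X ∩ lowPart n l ⊆ Y ∩ lowPart n l := by
      intro x hx
      rw [Finset.mem_inter, mem_lowPart] at hx
      have : (⟨x, hx.2⟩ : Fin l) ∈ t Y := h (by
        simp only [t, Finset.mem_filter, Finset.mem_univ, true_and]
        exact hx.1)
      simp only [t, Finset.mem_filter, Finset.mem_univ, true_and] at this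
      exact Finset.mem_inter.2 ⟨this, mem_lowPart.2 hx.2⟩
    rcases thinFamily_comparable (hA hX) (hA hY) h' with h1 | h1
    · exact hanti.eq hX hY h1
    · exact (hanti.eq hY hX h1).symm
  rw [← Finset.card_image_of_injOn (f := t) fun X hX Y hY h => key X hX Y hY h.subset]
  have hs : IsAntichain (· ⊆ ·) ((A.image t : Finset _) : Set (Finset (Fin l))) := by
    intro a ha b hb hab h
    obtain ⟨X, hX, rfl⟩ := Finset.mem_image.1 ha
    obtain ⟨Y, hY, rfl⟩ := Finset.mem_image.1 hb
    exact hab (by rw [key X hX Y hY h])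
  simpa using hs.sperner

/-- The members of `thinFamily n l M` that have `M` of the first `l` points and all the other
points below `c`. -/
def thinLayer (n l M c : ℕ) : Finset (Finset (Fin n)) :=
  (Finset.powersetCard M (lowPart n l)).image fun B => B ∪ (lowPart n c \ lowPart n l)

theorem mem_thinLayer {l M c : ℕ} {X : Finset (Fin n)} : X ∈ thinLayer n l M c ↔
    (X ∩ lowPart n l).card = M ∧ X \ lowPart n l = lowPart n c \ lowPart n l := by
  rw [thinLayer, Finset.mem_image]
  constructor
  · rintro ⟨B, hB, rfl⟩
    rw [Finset.mem_powersetCard] at hB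
    have h1 : (B ∪ (lowPart n c \ lowPart n l)) ∩ lowPart n l = B := by
      ext x
      have := @hB.1 x
      simp only [Finset.mem_inter, Finset.mem_union, Finset.mem_sdiff]
      tauto
    refine ⟨by rw [h1, hB.2], ?_⟩
    ext x
    have := @hB.1 x
    simp only [Finset.mem_union, Finset.mem_sdiff]
    tauto
  · rintro ⟨h1, h2⟩
    refine ⟨X ∩ lowPart n l, Finset.mem_powersetCard.2 ⟨Finset.inter_subset_right, h1⟩, ?_⟩
    rw [← h2, Finset.union_comm, Finset.sdiff_union_inter]

theorem card_thinLayer {l M c : ℕ} (hl : l ≤ n) :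
    (thinLayer n l M c).card = l.choose M := by
  rw [thinLayer, Finset.card_image_of_injOn, Finset.card_powersetCard, card_lowPart hl]
  intro B hB B' hB' h
  rw [Finset.mem_coe, Finset.mem_powersetCard] at hB hB'
  ext x
  have h1 := @hB.1 x
  have h2 := @hB'.1 x
  have h3 := congrArg (x ∈ ·) h
  simp only [Finset.mem_union, Finset.mem_sdiff] at h3
  have h4 := iff_of_eq h3
  tauto

theorem card_of_mem_thinLayer {l M c : ℕ} (hlc : l ≤ c) (hcn : c ≤ n) {X : Finset (Fin n)}
    (hX : X ∈ thinLayer n l M c) : X.card = M + (c - l) := by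
  rw [mem_thinLayer] at hX
  rw [← Finset.card_inter_add_card_sdiff X (lowPart n l), hX.1, hX.2,
    Finset.card_sdiff_of_subset (lowPart_mono hlc), card_lowPart hcn,
    card_lowPart (hlc.trans hcn)]

theorem thinLayer_subset {l M c : ℕ} (hlc : l ≤ c) (hcn : c ≤ n) :
    thinLayer n l M c ⊆ thinFamily n l M := by
  intro X hX
  rw [mem_thinLayer] at hX
  rw [mem_thinFamily]
  exact ⟨⟨c, hlc, hcn, hX.2⟩, fun h => absurd hX.1 h.ne, fun h => absurd hX.1 h.ne'⟩

theorem isWideAntichain_thinLayer {l M c : ℕ} (hlc : l ≤ c) (hcn : c ≤ n) :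
    IsWideAntichain (thinFamily n l M) (l.choose M) (thinLayer n l M c) := by
  refine ⟨thinLayer_subset hlc hcn, fun a ha b hb hab h => ?_,
    card_thinLayer (hlc.trans hcn)⟩
  exact hab (Finset.eq_of_subset_of_card_le h (by
    rw [card_of_mem_thinLayer hlc hcn ha, card_of_mem_thinLayer hlc hcn hb]))

/-- A missing set whose size lies between `M` and `M + (n - l)` is incomparable to the `thinLayer`
of its own size. A smaller one is incomparable to the lowest `thinLayer`, since below it the family
contains every subset of the first `l` points; dually for a larger one. -/
theorem isWidthSaturated_thinFamily {l M : ℕ} (hl : l ≤ n) (hM : M = l - l / 2) :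
    IsWidthSaturated (thinFamily n l M) (l.choose M) := by
  have hMw : l.choose M = l.choose (l / 2) := Nat.choose_symm_of_eq_add (by omega)
  refine ⟨fun A hA hanti => ?_, fun X hX => ?_⟩
  · rw [hMw]
    exact card_le_of_isAntichain_of_subset_thinFamily hl hA hanti
  have hcX := Finset.card_inter_add_card_sdiff X (lowPart n l)
  rcases lt_or_ge X.card M with h1 | h1
  · refine ⟨_, isWideAntichain_thinLayer le_rfl hl, fun Y hY => ⟨fun h => ?_, fun h => hX ?_⟩⟩
    · have h2 := Finset.card_le_card h
      rw [card_of_mem_thinLayer le_rfl hl hY] at h2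
      omega
    · rw [mem_thinLayer, sdiff_self] at hY
      have hXI : X ⊆ lowPart n l := h.trans (Finset.sdiff_eq_empty_iff_subset.1 hY.2)
      rw [mem_thinFamily]
      refine ⟨⟨l, le_rfl, hl, ?_⟩, fun _ => hXI, fun h => by omega⟩
      rw [Finset.sdiff_eq_empty_iff_subset.2 hXI, sdiff_self]; rfl
  rcases lt_or_ge (M + (n - l)) X.card with h2 | h2
  · refine ⟨_, isWideAntichain_thinLayer hl le_rfl, fun Y hY => ⟨fun h => hX ?_, fun h => ?_⟩⟩
    · rw [mem_thinLayer] at hY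
      have hXI : (lowPart n l)ᶜ ⊆ X := by
        intro x hx
        refine h (Finset.mem_sdiff.1 (?_ : x ∈ Y \ lowPart n l)).1
        rw [hY.2, Finset.mem_sdiff]
        exact ⟨mem_lowPart.2 x.2, Finset.mem_compl.1 hx⟩
      have he : X \ lowPart n l = lowPart n n \ lowPart n l := by
        ext x
        have := @hXI x
        simp only [Finset.mem_sdiff, Finset.mem_compl, mem_lowPart, x.2, true_and] at this ⊢
        tauto
      have hc := congrArg Finset.card he
      rw [Finset.card_sdiff_of_subset (lowPart_mono hl), card_lowPart le_rfl,
        card_lowPart hl] at hc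
      rw [mem_thinFamily]
      exact ⟨⟨n, hl, le_rfl, he⟩, fun h => by omega, fun _ => hXI⟩
    · have h3 := Finset.card_le_card h
      rw [card_of_mem_thinLayer hl le_rfl hY] at h3
      omega
  · have hlc : l ≤ l + (X.card - M) := Nat.le_add_right _ _
    have hcn : l + (X.card - M) ≤ n := by omega
    refine ⟨_, isWideAntichain_thinLayer hlc hcn, fun Y hY => ?_⟩
    have hYc := card_of_mem_thinLayer hlc hcn hY
    have hYF := thinLayer_subset hlc hcn hY
    refine ⟨fun h => hX ?_, fun h => hX ?_⟩
    · rwa [← Finset.eq_of_subset_of_card_le h (by omega)]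
    · rwa [Finset.eq_of_subset_of_card_le h (by omega)]

theorem card_thinFamily_le {l M : ℕ} (hl : l ≤ n) (hM : M ≤ l) :
    (thinFamily n l M).card ≤ ∑ j ∈ Finset.range M, l.choose j +
      ∑ j ∈ Finset.range (l - M), l.choose j + (n - l + 1) * l.choose M := by
  classical
  set I := lowPart n l
  have hIc : I.card = l := card_lowPart hl
  have hsub : thinFamily n l M ⊆
      ((Finset.range M).biUnion fun j => Finset.powersetCard j I) ∪
      ((Finset.range (l - M)).biUnion fun j =>
        (Finset.powersetCard (l - j) I).image fun B => B ∪ Iᶜ) ∪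
      (Finset.range (n - l + 1)).biUnion fun i => thinLayer n l M (l + i) := by
    intro X hX
    obtain ⟨⟨c, hlc, hcn, hc⟩, h1, h2⟩ := mem_thinFamily.1 hX
    have hXI : (X ∩ I).card ≤ l := hIc ▸ Finset.card_le_card Finset.inter_subset_right
    rcases lt_trichotomy (X ∩ I).card M with h | h | h
    · refine Finset.mem_union_left _ (Finset.mem_union_left _ (Finset.mem_biUnion.2 ?_))
      refine ⟨_, Finset.mem_range.2 h, Finset.mem_powersetCard.2 ⟨h1 h, ?_⟩⟩
      rw [Finset.inter_eq_left.2 (h1 h)]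
    · refine Finset.mem_union_right _ (Finset.mem_biUnion.2 ⟨c - l, ?_, ?_⟩)
      · rw [Finset.mem_range]; omega
      · rw [Nat.add_sub_cancel' hlc, mem_thinLayer]; exact ⟨h, hc⟩
    · refine Finset.mem_union_left _ (Finset.mem_union_right _ (Finset.mem_biUnion.2 ?_))
      refine ⟨l - (X ∩ I).card, Finset.mem_range.2 (by omega), Finset.mem_image.2
        ⟨X ∩ I, Finset.mem_powersetCard.2 ⟨Finset.inter_subset_right, by omega⟩, ?_⟩⟩
      ext x
      have : x ∈ Iᶜ → x ∈ X := fun hx => h2 h hx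
      simp only [Finset.mem_union, Finset.mem_inter, Finset.mem_compl] at this ⊢
      tauto
  refine (Finset.card_le_card hsub).trans ((Finset.card_union_le _ _).trans
    (Nat.add_le_add ((Finset.card_union_le _ _).trans (Nat.add_le_add ?_ ?_)) ?_))
  · refine Finset.card_biUnion_le.trans (Finset.sum_le_sum fun j _ => ?_)
    rw [Finset.card_powersetCard, hIc]
  · refine Finset.card_biUnion_le.trans (Finset.sum_le_sum fun j hj => ?_)
    refine Finset.card_image_le.trans ?_
    rw [Finset.mem_range] at hj
    rw [Finset.card_powersetCard, hIc, Nat.choose_symm (by omega)]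
  · refine Finset.card_biUnion_le.trans ?_
    rw [Finset.sum_congr rfl fun i _ => card_thinLayer hl, Finset.sum_const, Finset.card_range,
      smul_eq_mul]

end Extremal

/-! ### The value of the saturation number -/

theorem corollary1p4 (ℓ k n : ℕ)
    (hk : ((ℓ.choose (ℓ / 2) : ℕ) : ℤ) = (k : ℤ) - 1) :
    (n ≤ ℓ → satStar n k = 2 ^ n) ∧
    (ℓ + 1 ≤ n →
      (satStar n k : ℤ) =
        2 * ∑ j ∈ Finset.range (ℓ / 2 + 1), ((ℓ.choose j : ℕ) : ℤ)
          + ((k : ℤ) - 1) * ((n : ℤ) - 1 - 2 * ((ℓ / 2 : ℕ) : ℤ))) := by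
  obtain ⟨w, hw⟩ : ∃ w, w = ℓ.choose (ℓ / 2) := ⟨_, rfl⟩
  obtain rfl : k = w + 1 := by omega
  obtain ⟨⟨F, hF, hFc⟩, hle⟩ := satStar_isLeast n (Nat.succ_pos w)
  constructor
  · intro hn
    have hcube : n.choose (n / 2) ≤ w := by
      rw [hw]
      exact (Nat.choose_le_choose _ hn).trans (Nat.choose_le_middle _ _)
    have hFu : F = Finset.univ := by
      refine Finset.eq_univ_iff_forall.2 fun X => ?_
      by_contra hX
      obtain ⟨A, -, hA, hanti⟩ := hF.2 X hX
      have := hanti.sperner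
      rw [Fintype.card_fin] at this
      omega
    rw [← hFc, hFu, Finset.card_univ, Fintype.card_finset, Fintype.card_fin]
  · intro hn
    have hcube : w ≤ n.choose (n / 2) := by
      rw [hw]
      exact (Nat.choose_le_choose _ (by omega)).trans (Nat.choose_le_middle _ _)
    have hsat := hF.isWidthSaturated
    have hlower := hsat.le_card (hsat.exists_wideAntichain hcube) hw (by omega)
    have hM : ℓ.choose (ℓ - ℓ / 2) = w := by
      rw [hw]; exact Nat.choose_symm_of_eq_add (by omega)
    have hthin := isWidthSaturated_thinFamily (n := n) (l := ℓ) (by omega) rfl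
    rw [hM] at hthin
    have hupper := (hle ⟨_, hthin.antichainSaturated, rfl⟩).trans
      (card_thinFamily_le (M := ℓ - ℓ / 2) (by omega) (by omega))
    rw [hM, show ℓ - (ℓ - ℓ / 2) = ℓ / 2 by omega] at hupper
    rw [hFc] at hlower
    obtain ⟨d, rfl⟩ : ∃ d, n = 2 * (ℓ / 2) + 1 + d := ⟨n - (2 * (ℓ / 2) + 1), by omega⟩
    rw [Nat.add_sub_cancel_left] at hlower
    have hsum := Finset.sum_range_succ (fun j => ℓ.choose j) (ℓ / 2)
    rw [← hw] at hsum
    set s := ∑ j ∈ Finset.range (ℓ / 2), ℓ.choose j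
    have hval : satStar (2 * (ℓ / 2) + 1 + d) (w + 1) =
        2 * ∑ j ∈ Finset.range (ℓ / 2 + 1), ℓ.choose j + w * d := by
      refine le_antisymm (hupper.trans ?_) hlower
      rw [hsum]
      -- For even `ℓ` the two partial sums in the upper bound both stop before the middle. For odd
      -- `ℓ` one of them includes a central term, and `n ≥ ℓ + 1` forces `d ≥ 1`.
      rcases Nat.even_or_odd' ℓ with ⟨m, hm | hm⟩
      · rw [show ℓ - ℓ / 2 = ℓ / 2 by omega,
          show 2 * (ℓ / 2) + 1 + d - ℓ + 1 = d + 2 by omega]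
        exact le_of_eq (by ring)
      · obtain ⟨e, rfl⟩ : ∃ e, d = e + 1 := ⟨d - 1, by omega⟩
        rw [show ℓ - ℓ / 2 = ℓ / 2 + 1 by omega,
          show 2 * (ℓ / 2) + 1 + (e + 1) - ℓ + 1 = e + 2 by omega, hsum]
        exact le_of_eq (by ring)
    rw [hval]
    push_cast
    ring
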